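/- For an integer $r\ge 2$ and $a\in\mathbb Z^3$ let $G=\frac1r(a_1,a_2,a_3)\subset GL_3(\mathbb C)$ be the cyclic group generated by $\mathrm{diag}(\zeta^{a_1},\zeta^{a_2},\zeta^{a_3})$, $\zeta=e^{2\pi i/r}$, let $N=\mathbb Z^3+\mathbb Z\,\frac1r(a_1,a_2,a_3)\subset\mathbb R^3$ and $\sigma=\mathbb R_{\ge0}^3$. Let $\mathbf{Hilb}_N(\sigma)$ be the set of nonzero elements of $\sigma\cap N$ that are not a sum of two nonzero elements of $\sigma\cap N$. For a fan $\Delta$ subdividing $\sigma$ let $\mathrm{Gen}(\Delta)$ be the set of primitive lattice generators of its rays; $\Delta$ is a Hilbert desingularization of $\sigma$ if all its cones are smooth (generated by part of a $\mathbb Z$-basis of $N$) and $\mathrm{Gen}(\Delta)=\mathbf{Hilb}_N(\sigma)$. A Fujiki–Oka resolution of $\mathbb C^3/G$ is given by a generator $\frac1r(a_1,a_2,a_3)$ of $G$ with $0\le a_j<r$ and $a_i=1$ for some $i$, as follows. Start with the cone spanned by $(v_1,v_2,v_3)=(e_1,e_2,e_3)$, of type $\frac{(a_1,a_2,a_3)}r$.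 A cone of type $\frac{(a_1,a_2,a_3)}{r}$ with $r=1$ is kept. For $r>1$, put $c=\frac1r(a_1v_1+a_2v_2+a_3v_3)$ and replace the cone by the cones obtained by substituting $c$ for $v_j$, one for each $j$ with $a_j\ne0$: for $j=i$ the new cone is kept, and for $j\neq i$ it has type $\frac{(b_1,b_2,b_3)}{a_j}$, where $0\le b_k<a_j$, $b_k\equiv a_k$ for $k\ne j$ and $b_j\equiv -r$ modulo $a_j$; one continues with it and the same $i$. The fan consists of the cones that are kept and their faces. Theorem. Let $G$ be one of (a) $\frac1{dr}(1,dr-1,ad)$ with integers $d>1$, $0<a<r$, $\gcd(r,a)=1$; (b) $\frac1{4k}(1,2k+1,4k-2)$ with $k\ge2$; (c) $\frac19(1,4,7)$; (d) $\frac1{14}(1,9,11)$. Let $\Delta$ be the fan of any Fujiki–Oka resolution of $\mathbb C^3/G$. Let $F$ be the number of smooth three-dimensional cones of $\Delta$, and $V$ the number of vertices of the triangulation that $\Delta$ induces on $\sigma\cap\{x_1+x_2+x_3=1\}$. Then every cone of $\Delta$ is smooth. In cases (a) and (b), $F\ge 2|G|$. In case (c), $F=23$ and $V=14$; in case (d),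 $F=43$ and $V=24$. In all four cases $$V\ge|G|+3>|G|+2\ge\#\mathbf{Hilb}_N(\sigma),$$ and $\mathrm{Gen}(\Delta)\ne\mathbf{Hilb}_N(\sigma)$; so $\Delta$ is not a Hilbert desingularization of $\sigma$. -/

import Mathlib

namespace FujikiOka

noncomputable section

/-! ### Cyclic quotient singularities -/

/-- The diagonal matrix `diag(ζ ^ a₁, …, ζ ^ aₙ)`, `ζ = exp(2πi / r)`, as an element of `GLₙ(ℂ)`. -/
def diagElement {n : ℕ} (r : ℤ) (a : Fin n → ℤ) : GL (Fin n) ℂ where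
  val := Matrix.diagonal fun j => Complex.exp (2 * Real.pi * Complex.I * (a j / r))
  inv := Matrix.diagonal fun j => Complex.exp (-(2 * Real.pi * Complex.I * (a j / r)))
  val_inv := by
    rw [Matrix.diagonal_mul_diagonal, ← Matrix.diagonal_one]
    congr 1
    funext j
    rw [← Complex.exp_add, add_neg_cancel, Complex.exp_zero]
  inv_val := by
    rw [Matrix.diagonal_mul_diagonal, ← Matrix.diagonal_one]
    congr 1
    funext j
    rw [← Complex.exp_add, neg_add_cancel, Complex.exp_zero]

/-- The cyclic group `(1/r)(a₁, …, aₙ)` in `GLₙ(ℂ)`. -/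
def cyclicGroup {n : ℕ} (r : ℤ) (a : Fin n → ℤ) : Subgroup (GL (Fin n) ℂ) :=
  Subgroup.zpowers (diagElement r a)

/-- The lattice `N = ℤⁿ + ℤ · (1/r)(a₁, …, aₙ)` in `ℝⁿ`. -/
def cyclicLattice {n : ℕ} (r : ℤ) (a : Fin n → ℤ) : AddSubgroup (Fin n → ℝ) :=
  AddSubgroup.closure
    (Set.range (fun j : Fin n => (Pi.single j (1 : ℝ) : Fin n → ℝ)) ∪
      {fun j => (a j : ℝ) / (r : ℝ)})

/-! ### Cones and fans with respect to a lattice `N` -/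

/-- The Hilbert basis of the cone `σ` with respect to the lattice `N`. -/
def hilbertBasis {n : ℕ} (N : AddSubgroup (Fin n → ℝ)) (σ : PointedCone ℝ (Fin n → ℝ)) :
    Set (Fin n → ℝ) :=
  {v | (v ∈ σ ∧ v ∈ N ∧ v ≠ 0) ∧
    ¬ ∃ x y : Fin n → ℝ, (x ∈ σ ∧ x ∈ N ∧ x ≠ 0) ∧ (y ∈ σ ∧ y ∈ N ∧ y ≠ 0) ∧ v = x + y}

/-- `τ` is a rational strongly convex polyhedral cone. -/
def IsRationalCone {n : ℕ} (N : AddSubgroup (Fin n → ℝ)) (τ : PointedCone ℝ (Fin n → ℝ)) : Prop :=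
  (∃ S : Finset (Fin n → ℝ), (∀ v ∈ S, v ∈ N) ∧ τ = PointedCone.hull ℝ (S : Set (Fin n → ℝ))) ∧
    (τ : ConvexCone ℝ (Fin n → ℝ)).Salient

/-- A finite fan of rational strongly convex polyhedral cones. -/
structure IsFan {n : ℕ} (N : AddSubgroup (Fin n → ℝ))
    (Δ : Set (PointedCone ℝ (Fin n → ℝ))) : Prop where
  finite : Δ.Finite
  rational : ∀ τ ∈ Δ, IsRationalCone N τ
  face_mem : ∀ τ ∈ Δ, ∀ ρ : PointedCone ℝ (Fin n → ℝ), ρ.IsFaceOf τ → ρ ∈ Δ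
  inf_face : ∀ τ ∈ Δ, ∀ τ' ∈ Δ, (τ ⊓ τ').IsFaceOf τ ∧ (τ ⊓ τ').IsFaceOf τ'

/-- `Δ` is a fan subdividing the cone `σ`. -/
def IsSubdivision {n : ℕ} (N : AddSubgroup (Fin n → ℝ)) (σ : PointedCone ℝ (Fin n → ℝ))
    (Δ : Set (PointedCone ℝ (Fin n → ℝ))) : Prop :=
  IsFan N Δ ∧ (⋃ τ ∈ Δ, (τ : Set (Fin n → ℝ))) = (σ : Set (Fin n → ℝ))

/-- A cone is smooth if it is generated by a part of a `ℤ`-basis of `N`. -/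
def IsSmoothCone {n : ℕ} (N : AddSubgroup (Fin n → ℝ)) (τ : PointedCone ℝ (Fin n → ℝ)) : Prop :=
  ∃ (b : Module.Basis (Fin n) ℤ N) (s : Set (Fin n)),
    τ = PointedCone.hull ℝ ((fun j => ((b j : N) : Fin n → ℝ)) '' s)

/-- `Δ(m)`: the `m`-dimensional cones of `Δ`. -/
def conesOfDim {n : ℕ} (Δ : Set (PointedCone ℝ (Fin n → ℝ))) (m : ℕ) :
    Set (PointedCone ℝ (Fin n → ℝ)) :=
  {τ ∈ Δ | Module.finrank ℝ (Submodule.span ℝ (τ : Set (Fin n → ℝ))) = m}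

/-- `v` is the primitive lattice generator `P(ρ)` of the ray `ρ`. -/
def IsPrimitiveGenerator {n : ℕ} (N : AddSubgroup (Fin n → ℝ))
    (ρ : PointedCone ℝ (Fin n → ℝ)) (v : Fin n → ℝ) : Prop :=
  v ∈ N ∧ ρ = PointedCone.hull ℝ {v} ∧ ∀ u ∈ N, u ∈ ρ → ∃ m : ℕ, u = m • v

/-- `Gen(Δ)`: the union over `τ ∈ Δ` of the sets
`Gen(τ) = {P(ρ) | ρ ∈ Δ(1), ρ is a face of τ}`. -/
def gen {n : ℕ} (N : AddSubgroup (Fin n → ℝ)) (Δ : Set (PointedCone ℝ (Fin n → ℝ))) :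
    Set (Fin n → ℝ) :=
  ⋃ τ ∈ Δ, {v | ∃ ρ ∈ conesOfDim Δ 1, ρ.IsFaceOf τ ∧ IsPrimitiveGenerator N ρ v}

/-- A Hilbert desingularization of `σ`: a smooth subdivision `Δ` of `σ` with `Gen(Δ)` equal to the
Hilbert basis of `σ`. -/
def IsHilbertDesingularization {n : ℕ} (N : AddSubgroup (Fin n → ℝ))
    (σ : PointedCone ℝ (Fin n → ℝ)) (Δ : Set (PointedCone ℝ (Fin n → ℝ))) : Prop :=
  IsSubdivision N σ Δ ∧ (∀ τ ∈ Δ, IsSmoothCone N τ) ∧ gen N Δ = hilbertBasis N σ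

/-! ### Fujiki–Oka resolutions -/

/-- `(a₁, …, aₙ)/r` is a proper fraction that is semi-unimodular at the `i`-th entry. -/
def IsSemiUnimodular {n : ℕ} (r : ℤ) (a : Fin n → ℤ) (i : Fin n) : Prop :=
  (∀ j, 0 ≤ a j ∧ a j < r) ∧ a i = 1

/-- The numerators of the `j`-th remainder `R_j ((a₁, …, aₙ)/r)`, whose denominator is `a j`:
replace the `j`-th entry by `-r`, and reduce all entries modulo `a j` (used for `a j ≠ 0` only). -/
def remainder {n : ℕ} (r : ℤ) (a : Fin n → ℤ) (j : Fin n) : Fin n → ℤ :=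
  fun k => (if k = j then -r else a k) % a j

/-- The Oka center `(1/r)(a₁ v₁ + ⋯ + aₙ vₙ)` of the cone spanned by `v₁, …, vₙ`, when this cone is
of type `(a₁, …, aₙ)/r`. -/
def okaCenter {n : ℕ} (r : ℤ) (a : Fin n → ℤ) (v : Fin n → (Fin n → ℝ)) : Fin n → ℝ :=
  (1 / (r : ℝ)) • ∑ k, (a k : ℝ) • v k

/-- `MaxCone i r a v w`: the cone spanned by `w₁, …, wₙ` is one of the maximal cones of the
Fujiki–Oka subdivision of the cone spanned by `v₁, …, vₙ`, which is of type `(a₁, …, aₙ)/r` and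
semi-unimodular over `vᵢ`. If `r = 1` the cone is smooth and is kept. Otherwise it is subdivided
at the Oka center `c`, that is, some `v j` with `a j ≠ 0` is replaced by `c`: for `j = i` the new
cone is smooth, and for `j ≠ i` it is of type `R_j (a/r)`, is again semi-unimodular over `vᵢ`
(or smooth), and is subdivided further. -/
inductive MaxCone {n : ℕ} (i : Fin n) :
    ℤ → (Fin n → ℤ) → (Fin n → (Fin n → ℝ)) → (Fin n → (Fin n → ℝ)) → Prop
  | smooth (a : Fin n → ℤ) (v : Fin n → (Fin n → ℝ)) : MaxCone i 1 a v v
  | center (r : ℤ) (a : Fin n → ℤ) (v : Fin n → (Fin n → ℝ)) (hr : 1 < r) :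
      MaxCone i r a v (Function.update v i (okaCenter r a v))
  | step (r : ℤ) (a : Fin n → ℤ) (v : Fin n → (Fin n → ℝ)) (j : Fin n) (w : Fin n → (Fin n → ℝ))
      (hr : 1 < r) (hj : j ≠ i) (ha : a j ≠ 0)
      (hw : MaxCone i (a j) (remainder r a j) (Function.update v j (okaCenter r a v)) w) :
      MaxCone i r a v w

/-- The fan of the Fujiki–Oka resolution given by the semi-unimodular proper fraction
`(a₁, …, aₙ)/r` with `aᵢ = 1`: starting from the cone spanned by the standard basis of `ℝⁿ`, take
all the resulting maximal cones and all their faces. -/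
def fujikiOkaFan {n : ℕ} (r : ℤ) (a : Fin n → ℤ) (i : Fin n) :
    Set (PointedCone ℝ (Fin n → ℝ)) :=
  {τ | ∃ w : Fin n → (Fin n → ℝ), MaxCone i r a (fun j => Pi.single j 1) w ∧
    τ.IsFaceOf (PointedCone.hull ℝ (Set.range w))}

/-- `Δ` is the fan of a Fujiki–Oka resolution of `ℂⁿ / G`: it arises from some semi-unimodular
generator of `G`. -/
def IsFujikiOkaResolution {n : ℕ} (G : Subgroup (GL (Fin n) ℂ))
    (Δ : Set (PointedCone ℝ (Fin n → ℝ))) : Prop :=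
  ∃ (r : ℤ) (a : Fin n → ℤ) (i : Fin n),
    IsSemiUnimodular r a i ∧ cyclicGroup r a = G ∧ Δ = fujikiOkaFan r a i

/-- The number of smooth cones of maximal dimension in `Δ`. -/
def numSmoothMaxCones {n : ℕ} (N : AddSubgroup (Fin n → ℝ))
    (Δ : Set (PointedCone ℝ (Fin n → ℝ))) : ℕ :=
  {τ ∈ conesOfDim Δ n | IsSmoothCone N τ}.ncard

/-- The number of vertices of the triangulation that `Δ` induces on the junior simplex, that is, the
number of points in which the rays of `Δ` meet the hyperplane `x₁ + ⋯ + xₙ = 1`. -/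
def numVertices {n : ℕ} (Δ : Set (PointedCone ℝ (Fin n → ℝ))) : ℕ :=
  {x : Fin n → ℝ | ∃ ρ ∈ conesOfDim Δ 1, x ∈ ρ ∧ ∑ j, x j = 1}.ncard

end

end FujikiOka

/-!
Every maximal cone of a Fujiki–Oka subdivision is spanned by a `ℤ`-basis of `N`: by
`okaCenter_remainder`, replacing `v j` by the Oka center keeps the lattice spanned by the generators
and the center of the new cone (`MaxCone.closure_range`). Faces of simplicial cones are spanned by
subsets of the generators, so all cones are smooth. Different branches of the recursion produce
cones with disjoint interiors (`MaxCone.disjoint_openCone`), hence `F` is the number of leaves of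
the recursion, a function `maxConeCount` of the numerical type alone (`encard_maxCone`). Distinct
primitive vectors span distinct rays, hence `V` is the number of vectors occurring in the
recursion, and these can be computed in coordinates relative to the initial cone
(`vertexCoords`, `ncard_vertexVectors`).

The numbers `F` and `V` are linked by Euler's formula. Only the inequality `F + 5 ≤ 2 V` is needed
(`maxConeCount_add_five_le`), and it has an inductive proof that does not use that the cones fit
together along their edges: with weight `2` for interior vertices and `1` for vertices inside an
edge, `F - 1` is at most the total weight (`maxConeCount_le_sum_vertexWeight`). Thus `F ≥ 2 #G`
implies `V ≥ #G + 3`. On the other hand an element of the Hilbert basis is a standard basis vector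
or lies in the half-open unit cube, which contains `#G - 1` nonzero points of `N`
(`encard_hilbertBasis_le`). As all vectors counted by `V` are in `Gen(Δ)`, this set is too large to
be the Hilbert basis.

It remains to bound `F`. Up to a permutation of the coordinates, the semi-unimodular generators in
the first family are of type `(1, m - 1, y) / m` with `2 ≤ y ≤ m - 2`, and in the others there is
just the given one. Types `(1, x, y) / r` with `r ∣ 1 + x + y` give exactly `r` cones. In the first
family, taking remainders at `m - 1` repeatedly leads through the types `(1, s - 1, y) / s` and
splits off such a type of denominator `y` each time, so that
`F = (m - 1 - y) (1 + y) + 2 y + 1 ≥ 2 m` (`maxConeCount_sub_one`). In the second family the types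
`(1, 2 k + 1, s - 2) / s` with `s` even descend from `s = 4 k` to `s = 2 k + 2`, where the first
family takes over, and each step splits off a type `(1, x, y) / (2 k + 1)` such that
`2 k + 1 ∣ x + y + 2`, which gives at least `k + 1` cones (`le_maxConeCount_even`). The
last two groups are computed.
-/

namespace FujikiOka

/-! ### Simplicial cones -/

theorem eq_of_sum_smul_eq {n : ℕ} {v : Fin n → Fin n → ℝ} (hv : LinearIndependent ℝ v)
    {s t : Fin n → ℝ} (h : ∑ k, s k • v k = ∑ k, t k • v k) : s = t := by
  funext k
  have h0 : ∑ k, (s k - t k) • v k = 0 := by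
    simp only [sub_smul, Finset.sum_sub_distrib, h, sub_self]
  exact sub_eq_zero.1 (Fintype.linearIndependent_iff.1 hv _ h0 k)

theorem mem_hull_image {n : ℕ} {v : Fin n → Fin n → ℝ} {s : Set (Fin n)} {p : Fin n → ℝ} :
    p ∈ PointedCone.hull ℝ (v '' s) ↔
      ∃ t : Fin n → ℝ, (∀ k, 0 ≤ t k) ∧ (∀ k, k ∉ s → t k = 0) ∧ p = ∑ k, t k • v k := by
  constructor
  · intro hp
    induction hp using Submodule.span_induction with
    | mem x hx =>
      obtain ⟨k, hk, rfl⟩ := hx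
      refine ⟨Pi.single k 1, fun l => ?_, fun l hl => ?_, ?_⟩
      · by_cases h : l = k
        · subst h; simp
        · simp [h]
      · have : l ≠ k := fun h => hl (h ▸ hk)
        simp [this]
      · simp [Pi.single_apply, ite_smul]
    | zero => exact ⟨0, by simp, by simp, by simp⟩
    | add x y _ _ hx hy =>
      obtain ⟨t, ht, ht', rfl⟩ := hx
      obtain ⟨u, hu, hu', rfl⟩ := hy
      exact ⟨t + u, fun k => add_nonneg (ht k) (hu k),
        fun k hk => by simp [ht' k hk, hu' k hk], by simp [add_smul, Finset.sum_add_distrib]⟩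
    | smul a x _ hx =>
      obtain ⟨t, ht, ht', rfl⟩ := hx
      refine ⟨(a : ℝ) • t, fun k => mul_nonneg a.2 (ht k), fun k hk => by simp [ht' k hk], ?_⟩
      simp only [Pi.smul_apply, smul_eq_mul, mul_smul, ← Finset.smul_sum]
      rfl
  · rintro ⟨t, ht, ht', rfl⟩
    refine Submodule.sum_mem _ fun k _ => ?_
    by_cases hk : k ∈ s
    · exact Submodule.smul_mem _ (⟨t k, ht k⟩ : {c : ℝ // 0 ≤ c})
        (Submodule.subset_span ⟨k, hk, rfl⟩)
    · rw [ht' k hk, zero_smul]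
      exact Submodule.zero_mem _

theorem mem_hull_range {n : ℕ} {v : Fin n → Fin n → ℝ} {p : Fin n → ℝ} :
    p ∈ PointedCone.hull ℝ (Set.range v) ↔
      ∃ t : Fin n → ℝ, (∀ k, 0 ≤ t k) ∧ p = ∑ k, t k • v k := by
  rw [← Set.image_univ, mem_hull_image]
  simp

theorem mem_hull_singleton {n : ℕ} {u p : Fin n → ℝ} :
    p ∈ PointedCone.hull ℝ {u} ↔ ∃ t : ℝ, 0 ≤ t ∧ p = t • u := by
  rw [PointedCone.hull, Submodule.mem_span_singleton]
  constructor
  · rintro ⟨a, rfl⟩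
    exact ⟨a, a.2, rfl⟩
  · rintro ⟨t, ht, rfl⟩
    exact ⟨⟨t, ht⟩, rfl⟩

/-- The set of strictly positive combinations of `v`, that is, the relative interior of the
cone spanned by `v`. -/
def openCone {n : ℕ} (v : Fin n → Fin n → ℝ) : Set (Fin n → ℝ) :=
  {p | ∃ t : Fin n → ℝ, (∀ k, 0 < t k) ∧ p = ∑ k, t k • v k}

/-- The relative interior of a simplicial cone is determined by the cone as a set. -/
theorem mem_openCone_iff {n : ℕ} {v : Fin n → Fin n → ℝ} (hv : LinearIndependent ℝ v)
    {p : Fin n → ℝ} :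
    p ∈ openCone v ↔ p ∈ PointedCone.hull ℝ (Set.range v) ∧
      ∀ q ∈ PointedCone.hull ℝ (Set.range v), ∃ ε : ℝ, 0 < ε ∧
        p - ε • q ∈ PointedCone.hull ℝ (Set.range v) := by
  constructor
  · rintro ⟨t, ht, rfl⟩
    refine ⟨mem_hull_range.2 ⟨t, fun k => (ht k).le, rfl⟩, fun q hq => ?_⟩
    obtain ⟨u, hu, rfl⟩ := mem_hull_range.1 hq
    -- Any `ε` with `ε * u k ≤ t k` for all `k` will do.
    obtain ⟨ε, hε, hle⟩ : ∃ ε : ℝ, 0 < ε ∧ ∀ k, ε * u k ≤ t k := by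
      have h : ∀ k, ∃ ε : ℝ, 0 < ε ∧ ε * u k ≤ t k := fun k => by
        refine ⟨t k / (u k + 1), div_pos (ht k) (by linarith [hu k]), ?_⟩
        rw [div_mul_eq_mul_div, div_le_iff₀ (by linarith [hu k])]
        nlinarith [ht k, hu k]
      choose e he he' using h
      rcases isEmpty_or_nonempty (Fin n) with hn | hn
      · exact ⟨1, one_pos, fun k => hn.elim k⟩
      · obtain ⟨k₀, hk₀⟩ := Finite.exists_min e
        exact ⟨e k₀, he k₀, fun k =>
          (mul_le_mul_of_nonneg_right (hk₀ k) (hu k)).trans (he' k)⟩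
    refine ⟨ε, hε, mem_hull_range.2 ⟨fun k => t k - ε * u k, fun k => sub_nonneg.2 (hle k), ?_⟩⟩
    simp only [sub_smul, Finset.sum_sub_distrib, mul_smul, Finset.smul_sum]
  · rintro ⟨hp, h⟩
    obtain ⟨t, ht, rfl⟩ := mem_hull_range.1 hp
    obtain ⟨ε, hε, hmem⟩ := h (∑ k, (1 : ℝ) • v k)
      (mem_hull_range.2 ⟨fun _ => 1, fun _ => zero_le_one, rfl⟩)
    obtain ⟨u, hu, he⟩ := mem_hull_range.1 hmem
    refine ⟨t, fun k => ?_, rfl⟩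
    have h1 : ∑ k, (t k - ε) • v k = ∑ k, u k • v k := by
      rw [← he]
      simp only [sub_smul, Finset.sum_sub_distrib, Finset.smul_sum, one_smul]
    have h2 := congrFun (eq_of_sum_smul_eq hv h1) k
    have h3 := hu k
    linarith

theorem openCone_eq_of_hull_eq {n : ℕ} {v w : Fin n → Fin n → ℝ} (hv : LinearIndependent ℝ v)
    (hw : LinearIndependent ℝ w)
    (h : PointedCone.hull ℝ (Set.range v) = PointedCone.hull ℝ (Set.range w)) :
    openCone v = openCone w := by
  ext p
  rw [mem_openCone_iff hv, mem_openCone_iff hw, h]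

theorem openCone_nonempty {n : ℕ} (v : Fin n → Fin n → ℝ) : (openCone v).Nonempty :=
  ⟨_, fun _ => 1, fun _ => one_pos, rfl⟩

theorem not_disjoint_openCone_self {n : ℕ} (v : Fin n → Fin n → ℝ) :
    ¬ Disjoint (openCone v) (openCone v) := fun h => by
  obtain ⟨p, hp⟩ := openCone_nonempty v
  exact Set.disjoint_left.1 h hp hp

/-- A face of a cone spanned by finitely many vectors is spanned by some of them. -/
theorem exists_hull_image_of_isFaceOf {n : ℕ} {w : Fin n → Fin n → ℝ}
    {τ : PointedCone ℝ (Fin n → ℝ)} (h : τ.IsFaceOf (PointedCone.hull ℝ (Set.range w))) :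
    ∃ s : Set (Fin n), τ = PointedCone.hull ℝ (w '' s) := by
  refine ⟨{k | w k ∈ τ}, le_antisymm (fun p hp => ?_) ?_⟩
  · obtain ⟨t, ht, rfl⟩ := mem_hull_range.1 (h.le hp)
    refine mem_hull_image.2 ⟨t, ht, fun k hk => ?_, rfl⟩
    by_contra h0
    exact hk (h.mem_of_sum_smul_mem (fun l => PointedCone.subset_hull ⟨l, rfl⟩) ht hp k
      (lt_of_le_of_ne (ht k) (Ne.symm h0)))
  · refine Submodule.span_le.2 ?_
    rintro _ ⟨k, hk, rfl⟩
    exact hk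

theorem isFaceOf_hull_image {n : ℕ} {w : Fin n → Fin n → ℝ} (hw : LinearIndependent ℝ w)
    (s : Set (Fin n)) :
    (PointedCone.hull ℝ (w '' s)).IsFaceOf (PointedCone.hull ℝ (Set.range w)) where
  le := Submodule.span_mono (Set.image_subset_range w s)
  mem_of_smul_add_mem := by
    intro x y a hx hy ha hxy
    obtain ⟨t, ht, rfl⟩ := mem_hull_range.1 hx
    obtain ⟨u, hu, rfl⟩ := mem_hull_range.1 hy
    obtain ⟨z, -, hz', he⟩ := mem_hull_image.1 hxy
    have h1 : ∑ k, (a * t k + u k) • w k = ∑ k, z k • w k := by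
      rw [← he]
      simp only [add_smul, Finset.sum_add_distrib, mul_smul, Finset.smul_sum]
    refine mem_hull_image.2 ⟨t, ht, fun k hk => ?_, rfl⟩
    have h2 := congrFun (eq_of_sum_smul_eq hw h1) k
    rw [hz' k hk] at h2
    have h3 : a * t k = 0 := le_antisymm (by linarith [hu k]) (mul_nonneg ha.le (ht k))
    exact (mul_eq_zero.1 h3).resolve_left ha.ne'

theorem finrank_span_hull_image {n : ℕ} {w : Fin n → Fin n → ℝ} (hw : LinearIndependent ℝ w)
    (s : Set (Fin n)) :
    Module.finrank ℝ (Submodule.span ℝ (PointedCone.hull ℝ (w '' s) : Set (Fin n → ℝ))) =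
      s.ncard := by
  classical
  have h : Submodule.span ℝ (PointedCone.hull ℝ (w '' s) : Set (Fin n → ℝ)) =
      Submodule.span ℝ (w '' s) :=
    le_antisymm (Submodule.span_le.2 fun _ hx => PointedCone.hull_le_span ℝ _ hx)
      (Submodule.span_mono PointedCone.subset_hull)
  have hr := finrank_span_eq_card (hw.comp ((↑) : s → Fin n) Subtype.val_injective)
  rw [Set.range_comp, Subtype.range_coe] at hr
  rw [h, hr, ← Nat.card_eq_fintype_card, Nat.card_coe_set_eq]

/-! ### One step of the Fujiki–Oka subdivision -/

/-- The invariant of the recursion defining `MaxCone`: the entries of `a` are residues modulo `r`,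
and the `i`-th one is the residue of `1`. For `r > 1` this is semi-unimodularity at `i`, and for
`r = 1` it says `a = 0`. -/
structure IsReduced {n : ℕ} (r : ℤ) (a : Fin n → ℤ) (i : Fin n) : Prop where
  pos : 0 < r
  nonneg : ∀ j, 0 ≤ a j
  lt : ∀ j, a j < r
  eq_one_mod : a i = 1 % r

theorem IsSemiUnimodular.one_lt {n : ℕ} {r : ℤ} {a : Fin n → ℤ} {i : Fin n}
    (h : IsSemiUnimodular r a i) : 1 < r := h.2 ▸ (h.1 i).2

theorem IsSemiUnimodular.isReduced {n : ℕ} {r : ℤ} {a : Fin n → ℤ} {i : Fin n}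
    (h : IsSemiUnimodular r a i) : IsReduced r a i where
  pos := zero_lt_one.trans h.one_lt
  nonneg j := (h.1 j).1
  lt j := (h.1 j).2
  eq_one_mod := by rw [h.2, Int.emod_eq_of_lt zero_le_one h.one_lt]

theorem IsReduced.eq_one {n : ℕ} {r : ℤ} {a : Fin n → ℤ} {i : Fin n} (h : IsReduced r a i)
    (hr : 1 < r) : a i = 1 := by
  rw [h.eq_one_mod, Int.emod_eq_of_lt zero_le_one hr]

theorem IsReduced.remainder {n : ℕ} {r : ℤ} {a : Fin n → ℤ} {i j : Fin n} (h : IsReduced r a i)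
    (hr : 1 < r) (hj : j ≠ i) (ha : a j ≠ 0) : IsReduced (a j) (remainder r a j) i where
  pos := lt_of_le_of_ne (h.nonneg j) (Ne.symm ha)
  nonneg _ := Int.emod_nonneg _ ha
  lt _ := Int.emod_lt_of_pos _ (lt_of_le_of_ne (h.nonneg j) (Ne.symm ha))
  eq_one_mod := by simp [FujikiOka.remainder, hj.symm, h.eq_one hr]

theorem smul_okaCenter {n : ℕ} {r : ℤ} (hr : r ≠ 0) (a : Fin n → ℤ) (v : Fin n → Fin n → ℝ) :
    (r : ℝ) • okaCenter r a v = ∑ k, (a k : ℝ) • v k := by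
  have : (r : ℝ) ≠ 0 := by exact_mod_cast hr
  rw [okaCenter, smul_smul, mul_one_div_cancel this, one_smul]

theorem sum_smul_update {n : ℕ} (s : Fin n → ℝ) (v : Fin n → Fin n → ℝ) (j : Fin n)
    (c : Fin n → ℝ) :
    ∑ k, s k • Function.update v j c k = s j • c + ∑ k, (if k = j then 0 else s k) • v k := by
  have h : ∀ k, s k • Function.update v j c k =
      (if k = j then s j • c else 0) + (if k = j then 0 else s k) • v k := fun k => by
    by_cases hk : k = j
    · subst hk; simp
    · simp [hk]
  simp only [h, Finset.sum_add_distrib, Finset.sum_ite_eq', Finset.mem_univ, if_true]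

/-- Coordinates with respect to the old cone in terms of those with respect to a new one. -/
theorem sum_smul_update_okaCenter {n : ℕ} (r : ℤ) (a : Fin n → ℤ) (v : Fin n → Fin n → ℝ)
    (j : Fin n) (s : Fin n → ℝ) :
    ∑ k, s k • Function.update v j (okaCenter r a v) k =
      ∑ k, ((if k = j then 0 else s k) + s j * (a k / r)) • v k := by
  rw [sum_smul_update]
  simp only [okaCenter, add_smul, Finset.sum_add_distrib, Finset.smul_sum, smul_smul]
  rw [add_comm]
  congr 1
  refine Finset.sum_congr rfl fun k _ => ?_
  congr 1
  ring

theorem linearIndependent_update_okaCenter {n : ℕ} {r : ℤ} (hr : r ≠ 0) {a : Fin n → ℤ}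
    {v : Fin n → Fin n → ℝ} (hv : LinearIndependent ℝ v) {j : Fin n} (ha : a j ≠ 0) :
    LinearIndependent ℝ (Function.update v j (okaCenter r a v)) := by
  rw [Fintype.linearIndependent_iff] at hv ⊢
  intro s hs k
  rw [sum_smul_update_okaCenter] at hs
  have h := hv _ hs
  have hr' : (r : ℝ) ≠ 0 := by exact_mod_cast hr
  have ha' : (a j : ℝ) ≠ 0 := by exact_mod_cast ha
  have hj : s j = 0 := by
    have := h j
    rw [if_pos rfl, zero_add] at this
    exact (mul_eq_zero.1 this).resolve_right (div_ne_zero ha' hr')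
  by_cases hk : k = j
  · rw [hk, hj]
  · simpa [hk, hj] using h k

theorem openCone_update_subset {n : ℕ} {r : ℤ} (hr : 0 < r) {a : Fin n → ℤ} (ha : ∀ k, 0 ≤ a k)
    {v : Fin n → Fin n → ℝ} {j : Fin n} (hj : 0 < a j) :
    openCone (Function.update v j (okaCenter r a v)) ⊆ openCone v := by
  rintro p ⟨s, hs, rfl⟩
  have hr' : (0 : ℝ) < r := by exact_mod_cast hr
  have hj' : (0 : ℝ) < a j := by exact_mod_cast hj
  refine ⟨_, fun k => ?_, sum_smul_update_okaCenter r a v j s⟩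
  by_cases hk : k = j
  · subst hk
    rw [if_pos rfl, zero_add]
    exact mul_pos (hs k) (div_pos hj' hr')
  · have : (0 : ℝ) ≤ a k := by exact_mod_cast ha k
    rw [if_neg hk]
    exact add_pos_of_pos_of_nonneg (hs k) (mul_nonneg (hs j).le (div_nonneg this hr'.le))

/-- A point `∑ t k • v k` in the interior of the cone in which `v j` is replaced by the center
satisfies `t j / a j < t l / a l`, so two different such cones have no interior point in common. -/
theorem disjoint_openCone_update {n : ℕ} {r : ℤ} {a : Fin n → ℤ}
    {v : Fin n → Fin n → ℝ} (hv : LinearIndependent ℝ v) {j l : Fin n} (hjl : j ≠ l)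
    (hj : 0 < a j) (hl : 0 < a l) :
    Disjoint (openCone (Function.update v j (okaCenter r a v)))
      (openCone (Function.update v l (okaCenter r a v))) := by
  rw [Set.disjoint_left]
  rintro p ⟨s, hs, rfl⟩ ⟨t, ht, he⟩
  rw [sum_smul_update_okaCenter, sum_smul_update_okaCenter] at he
  have h := eq_of_sum_smul_eq hv he
  have h1 := congrFun h j
  have h2 := congrFun h l
  simp only [if_neg hjl, if_neg hjl.symm, if_true] at h1 h2
  have hj' : (0 : ℝ) < a j := by exact_mod_cast hj
  have hl' : (0 : ℝ) < a l := by exact_mod_cast hl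
  have h3 := mul_pos hj' (hs l)
  have h4 := mul_pos hl' (ht j)
  have h5 : (a l : ℝ) * (0 + s j * (a j / r)) = a l * (t j + t l * (a j / r)) := by rw [h1]
  have h6 : (a j : ℝ) * (s l + s j * (a l / r)) = a j * (0 + t l * (a l / r)) := by rw [h2]
  have h7 : (a j : ℝ) * (s j * (a l / r)) = a l * (s j * (a j / r)) := by ring
  have h8 : (a j : ℝ) * (t l * (a l / r)) = a l * (t l * (a j / r)) := by ring
  rw [zero_add, mul_add] at h5 h6
  linarith

/-- The lattice generated by the `v k` and the Oka center, which is the ambient lattice when the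
cone spanned by `v` is of type `a / r`. -/
def typeLattice {n : ℕ} (r : ℤ) (a : Fin n → ℤ) (v : Fin n → Fin n → ℝ) :
    AddSubgroup (Fin n → ℝ) :=
  AddSubgroup.closure (insert (okaCenter r a v) (Set.range v))

theorem typeLattice_le_iff {n : ℕ} {r : ℤ} {a : Fin n → ℤ} {v : Fin n → Fin n → ℝ}
    {L : AddSubgroup (Fin n → ℝ)} :
    typeLattice r a v ≤ L ↔ okaCenter r a v ∈ L ∧ ∀ k, v k ∈ L := by
  rw [typeLattice, AddSubgroup.closure_le, Set.insert_subset_iff, Set.range_subset_iff]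
  rfl

theorem intCast_smul_mem {n : ℕ} {L : AddSubgroup (Fin n → ℝ)} (z : ℤ) {u : Fin n → ℝ}
    (hu : u ∈ L) : (z : ℝ) • u ∈ L := by
  rw [Int.cast_smul_eq_zsmul]
  exact L.zsmul_mem hu z

theorem update_mem_typeLattice {n : ℕ} (r : ℤ) (a : Fin n → ℤ) (v : Fin n → Fin n → ℝ)
    (j k : Fin n) : Function.update v j (okaCenter r a v) k ∈ typeLattice r a v := by
  obtain ⟨h1, h2⟩ := typeLattice_le_iff.1 (le_refl (typeLattice r a v))
  by_cases hk : k = j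
  · subst hk; simpa using h1
  · simpa [hk] using h2 k

/-- Modulo the lattice spanned by the new cone, the new Oka center is the negative of the vertex
that was replaced. -/
theorem okaCenter_remainder {n : ℕ} {r : ℤ} (hr : r ≠ 0) (a : Fin n → ℤ)
    (v : Fin n → Fin n → ℝ) {j : Fin n} (ha : a j ≠ 0) :
    okaCenter (a j) (remainder r a j) (Function.update v j (okaCenter r a v)) =
      -v j - ∑ k, (((if k = j then -r else a k) / a j : ℤ) : ℝ) •
        Function.update v j (okaCenter r a v) k := by
  have ha' : (a j : ℝ) ≠ 0 := by exact_mod_cast ha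
  have hrem : ∀ k, (remainder r a j k : ℝ) =
      ((if k = j then -r else a k : ℤ) : ℝ) - a j * (((if k = j then -r else a k) / a j : ℤ) : ℝ) :=
    fun k => by
      rw [remainder, Int.emod_def]
      push_cast
      ring
  have hsum : ∑ k, ((if k = j then -r else a k : ℤ) : ℝ) •
      Function.update v j (okaCenter r a v) k = -((a j : ℝ) • v j) := by
    have h0 : ∑ k, (if k = j then (0 : ℝ) else ((if k = j then -r else a k : ℤ) : ℝ)) • v k =
        ∑ k, ((a k : ℝ) • v k - if k = j then (a j : ℝ) • v j else 0) :=
      Finset.sum_congr rfl fun k _ => by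
        by_cases hk : k = j
        · subst hk; simp
        · simp [hk]
    rw [sum_smul_update, h0, Finset.sum_sub_distrib, ← smul_okaCenter hr]
    simp only [if_true, Finset.sum_ite_eq', Finset.mem_univ, Int.cast_neg, neg_smul]
    abel
  have hsub : ∑ k, (remainder r a j k : ℝ) • Function.update v j (okaCenter r a v) k =
      -((a j : ℝ) • v j) - (a j : ℝ) • ∑ k, (((if k = j then -r else a k) / a j : ℤ) : ℝ) •
        Function.update v j (okaCenter r a v) k := by
    simp only [hrem, sub_smul, Finset.sum_sub_distrib, hsum, mul_smul, Finset.smul_sum]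
  rw [okaCenter, hsub, ← smul_neg, ← smul_sub, smul_smul, one_div_mul_cancel ha', one_smul]

theorem typeLattice_remainder {n : ℕ} {r : ℤ} (hr : r ≠ 0) (a : Fin n → ℤ)
    (v : Fin n → Fin n → ℝ) {j : Fin n} (ha : a j ≠ 0) :
    typeLattice (a j) (remainder r a j) (Function.update v j (okaCenter r a v)) =
      typeLattice r a v := by
  have hc := okaCenter_remainder hr a v ha
  refine le_antisymm (typeLattice_le_iff.2 ⟨?_, update_mem_typeLattice r a v j⟩)
    (typeLattice_le_iff.2 ?_)
  · rw [hc]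
    exact sub_mem (neg_mem ((typeLattice_le_iff.1 le_rfl).2 j))
      (sum_mem fun k _ => intCast_smul_mem _ (update_mem_typeLattice r a v j k))
  · obtain ⟨h1, h2⟩ := typeLattice_le_iff.1 (le_refl (typeLattice (a j) (remainder r a j)
      (Function.update v j (okaCenter r a v))))
    refine ⟨by simpa using h2 j, fun k => ?_⟩
    by_cases hk : k = j
    · subst hk
      rw [show v k = -okaCenter (a k) (remainder r a k) (Function.update v k (okaCenter r a v)) -
        ∑ l, (((if l = k then -r else a l) / a k : ℤ) : ℝ) •
          Function.update v k (okaCenter r a v) l by rw [hc]; abel]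
      exact sub_mem (neg_mem h1) (sum_mem fun l _ => intCast_smul_mem _ (h2 l))
    · simpa [hk] using h2 k

theorem closure_range_update_okaCenter {n : ℕ} {r : ℤ} (hr : r ≠ 0) {a : Fin n → ℤ}
    (v : Fin n → Fin n → ℝ) {i : Fin n} (ha : a i = 1) :
    AddSubgroup.closure (Set.range (Function.update v i (okaCenter r a v))) =
      typeLattice r a v := by
  refine le_antisymm ((AddSubgroup.closure_le _).2 ?_) (typeLattice_le_iff.2 ?_)
  · rintro _ ⟨k, rfl⟩
    exact update_mem_typeLattice r a v i k
  · have h2 : ∀ k, Function.update v i (okaCenter r a v) k ∈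
        AddSubgroup.closure (Set.range (Function.update v i (okaCenter r a v))) :=
      fun k => AddSubgroup.subset_closure ⟨k, rfl⟩
    have hc := h2 i
    rw [Function.update_self] at hc
    refine ⟨hc, fun k => ?_⟩
    by_cases hk : k = i
    · subst hk
      have h := smul_okaCenter hr a v
      rw [← Finset.add_sum_erase _ _ (Finset.mem_univ k), ha, Int.cast_one, one_smul] at h
      rw [← sub_eq_iff_eq_add.2 h]
      refine sub_mem (intCast_smul_mem _ hc) (sum_mem fun l hl => intCast_smul_mem _ ?_)
      simpa [Finset.ne_of_mem_erase hl] using h2 l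
    · simpa [hk] using h2 k

/-! ### The maximal cones of the Fujiki–Oka subdivision -/

theorem MaxCone.linearIndependent {n : ℕ} {i : Fin n} {r : ℤ} {a : Fin n → ℤ}
    {v w : Fin n → Fin n → ℝ} (h : MaxCone i r a v w) (ha : IsReduced r a i)
    (hv : LinearIndependent ℝ v) : LinearIndependent ℝ w := by
  induction h with
  | smooth => exact hv
  | center r a v hr =>
    exact linearIndependent_update_okaCenter ha.pos.ne' hv (by simp [ha.eq_one hr])
  | step r a v j w hr hj haj hw ih =>
    exact ih (ha.remainder hr hj haj) (linearIndependent_update_okaCenter ha.pos.ne' hv haj)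

theorem MaxCone.closure_range {n : ℕ} {i : Fin n} {r : ℤ} {a : Fin n → ℤ}
    {v w : Fin n → Fin n → ℝ} (h : MaxCone i r a v w) (ha : IsReduced r a i) :
    AddSubgroup.closure (Set.range w) = typeLattice r a v := by
  induction h with
  | smooth a v =>
    have h0 : ∀ k, a k = 0 := fun k => by linarith [ha.nonneg k, ha.lt k]
    refine le_antisymm (AddSubgroup.closure_mono (Set.subset_insert _ _))
      (typeLattice_le_iff.2 ⟨?_, fun k => AddSubgroup.subset_closure ⟨k, rfl⟩⟩)
    simp [okaCenter, h0]
  | center r a v hr => exact closure_range_update_okaCenter ha.pos.ne' v (ha.eq_one hr)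
  | step r a v j w hr hj haj hw ih =>
    rw [ih (ha.remainder hr hj haj), typeLattice_remainder ha.pos.ne' a v haj]

theorem MaxCone.openCone_subset {n : ℕ} {i : Fin n} {r : ℤ} {a : Fin n → ℤ}
    {v w : Fin n → Fin n → ℝ} (h : MaxCone i r a v w) (ha : IsReduced r a i) :
    openCone w ⊆ openCone v := by
  induction h with
  | smooth => exact subset_rfl
  | center r a v hr =>
    exact openCone_update_subset ha.pos ha.nonneg (by simp [ha.eq_one hr])
  | step r a v j w hr hj haj hw ih =>
    exact (ih (ha.remainder hr hj haj)).trans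
      (openCone_update_subset ha.pos ha.nonneg (ha.remainder hr hj haj).pos)

theorem MaxCone.disjoint_openCone {n : ℕ} {i : Fin n} {r : ℤ} {a : Fin n → ℤ}
    {v w w' : Fin n → Fin n → ℝ} (h : MaxCone i r a v w) (h' : MaxCone i r a v w')
    (ha : IsReduced r a i) (hv : LinearIndependent ℝ v) (hne : w ≠ w') :
    Disjoint (openCone w) (openCone w') := by
  induction h with
  | smooth =>
    cases h' with
    | smooth => exact absurd rfl hne
    | center _ _ _ hr => exact absurd hr (lt_irrefl _)
    | step _ _ _ _ _ hr => exact absurd hr (lt_irrefl _)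
  | center r a v hr =>
    cases h' with
    | smooth => exact absurd hr (lt_irrefl _)
    | center => exact absurd rfl hne
    | step _ _ _ j _ _ hj haj hw =>
      have hred := ha.remainder hr hj haj
      exact (disjoint_openCone_update hv hj.symm (by simp [ha.eq_one hr]) hred.pos).mono_right
        (hw.openCone_subset hred)
  | step r a v j w hr hj haj hw ih =>
    have hred := ha.remainder hr hj haj
    cases h' with
    | smooth => exact absurd hr (lt_irrefl _)
    | center =>
      exact (disjoint_openCone_update hv hj hred.pos (by simp [ha.eq_one hr])).mono_left
        (hw.openCone_subset hred)
    | step _ _ _ l _ _ hl hal hw' =>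
      by_cases hjl : j = l
      · subst hjl
        exact ih hw' hred (linearIndependent_update_okaCenter ha.pos.ne' hv haj) hne
      · have hred' := ha.remainder hr hl hal
        exact (disjoint_openCone_update hv hjl hred.pos hred'.pos).mono
          (hw.openCone_subset hred) (hw'.openCone_subset hred')

theorem MaxCone.eq_of_hull_eq {n : ℕ} {i : Fin n} {r : ℤ} {a : Fin n → ℤ}
    {v w w' : Fin n → Fin n → ℝ} (h : MaxCone i r a v w) (h' : MaxCone i r a v w')
    (ha : IsReduced r a i) (hv : LinearIndependent ℝ v)
    (he : PointedCone.hull ℝ (Set.range w) = PointedCone.hull ℝ (Set.range w')) : w = w' := by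
  by_contra hne
  have hd := h.disjoint_openCone h' ha hv hne
  rw [openCone_eq_of_hull_eq (h.linearIndependent ha hv) (h'.linearIndependent ha hv) he] at hd
  exact not_disjoint_openCone_self w' hd

theorem MaxCone.mem_hull {n : ℕ} {i : Fin n} {r : ℤ} {a : Fin n → ℤ}
    {v w : Fin n → Fin n → ℝ} (h : MaxCone i r a v w) (ha : IsReduced r a i) (k : Fin n) :
    w k ∈ PointedCone.hull ℝ (Set.range v) := by
  have key : ∀ (r : ℤ) (a : Fin n → ℤ) (v : Fin n → Fin n → ℝ), IsReduced r a i → ∀ j l,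
      Function.update v j (okaCenter r a v) l ∈ PointedCone.hull ℝ (Set.range v) := by
    intro r a v ha j l
    by_cases hl : l = j
    · subst hl
      rw [Function.update_self]
      refine mem_hull_range.2 ⟨fun k => (1 / (r : ℝ)) * a k, fun k => ?_, ?_⟩
      · have h1 : (0 : ℝ) < r := by exact_mod_cast ha.pos
        have h2 : (0 : ℝ) ≤ a k := by exact_mod_cast ha.nonneg k
        positivity
      · simp only [okaCenter, Finset.smul_sum, smul_smul]
    · rw [Function.update_of_ne hl]
      exact PointedCone.subset_hull ⟨l, rfl⟩
  induction h with
  | smooth a v => exact PointedCone.subset_hull ⟨k, rfl⟩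
  | center r a v hr => exact key r a v ha i k
  | step r a v j w hr hj haj hw ih =>
    refine Submodule.span_le.2 ?_ (ih (ha.remainder hr hj haj))
    rintro _ ⟨l, rfl⟩
    exact key r a v ha j l

/-! ### Lattice bases and primitive generators -/

theorem exists_int_of_smul_mem {n : ℕ} {w : Fin n → Fin n → ℝ} (hw : LinearIndependent ℝ w)
    {t : ℝ} {k : Fin n} (h : t • w k ∈ AddSubgroup.closure (Set.range w)) : ∃ z : ℤ, t = z := by
  obtain ⟨z, hz⟩ := AddSubgroup.exists_of_mem_closure_range _ _ h
  have h1 : ∑ l, (Pi.single k t : Fin n → ℝ) l • w l = ∑ l, (z l : ℝ) • w l := by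
    simp only [Int.cast_smul_eq_zsmul, ← hz]
    simp [Pi.single_apply, ite_smul]
  refine ⟨z k, ?_⟩
  simpa using congrFun (eq_of_sum_smul_eq hw h1) k

/-- Two members of `ℤ`-bases of one lattice that span the same ray are equal. -/
theorem eq_of_eq_smul_of_closure_eq {n : ℕ} {w w' : Fin n → Fin n → ℝ}
    (hw : LinearIndependent ℝ w) (hw' : LinearIndependent ℝ w')
    (h : AddSubgroup.closure (Set.range w) = AddSubgroup.closure (Set.range w')) {k k' : Fin n}
    {t : ℝ} (ht : 0 ≤ t) (he : w k = t • w' k') : w k = w' k' := by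
  have ht0 : t ≠ 0 := fun h0 => hw.ne_zero k (by rw [he, h0, zero_smul])
  have hk : w k ∈ AddSubgroup.closure (Set.range w) := AddSubgroup.subset_closure ⟨k, rfl⟩
  have hk' : w' k' ∈ AddSubgroup.closure (Set.range w') := AddSubgroup.subset_closure ⟨k', rfl⟩
  obtain ⟨z, hz⟩ : ∃ z : ℤ, t = z := exists_int_of_smul_mem hw' (by rw [← he, ← h]; exact hk)
  obtain ⟨y, hy⟩ : ∃ y : ℤ, t⁻¹ = y := by
    refine exists_int_of_smul_mem hw (k := k) ?_
    rw [he, smul_smul, inv_mul_cancel₀ ht0, one_smul, h]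
    exact hk'
  have h1 : z * y = 1 := by
    have := mul_inv_cancel₀ ht0
    rw [hy, hz] at this
    exact_mod_cast this
  have hz0 : 0 ≤ z := by rw [hz] at ht; exact_mod_cast ht
  rw [he, hz, Int.eq_one_of_mul_eq_one_right hz0 h1, Int.cast_one, one_smul]

theorem isPrimitiveGenerator_of_basis {n : ℕ} {w : Fin n → Fin n → ℝ}
    (hw : LinearIndependent ℝ w) (k : Fin n) :
    IsPrimitiveGenerator (AddSubgroup.closure (Set.range w)) (PointedCone.hull ℝ {w k}) (w k) := by
  refine ⟨AddSubgroup.subset_closure ⟨k, rfl⟩, rfl, fun u hu hu' => ?_⟩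
  obtain ⟨t, ht, rfl⟩ := mem_hull_singleton.1 hu'
  obtain ⟨z, rfl⟩ := exists_int_of_smul_mem hw hu
  lift z to ℕ using by exact_mod_cast ht
  exact ⟨z, by rw [Int.cast_natCast, Nat.cast_smul_eq_nsmul]⟩

theorem isSmoothCone_hull_image {n : ℕ} {w : Fin n → Fin n → ℝ} (hw : LinearIndependent ℝ w)
    (s : Set (Fin n)) :
    IsSmoothCone (AddSubgroup.closure (Set.range w)) (PointedCone.hull ℝ (w '' s)) := by
  have hmem : ∀ k, w k ∈ AddSubgroup.closure (Set.range w) :=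
    fun k => AddSubgroup.subset_closure ⟨k, rfl⟩
  have hli : LinearIndependent ℤ
      (fun k => (⟨w k, hmem k⟩ : AddSubgroup.closure (Set.range w))) := by
    rw [Fintype.linearIndependent_iff]
    intro z hz k
    have h0 := congrArg (AddSubgroup.closure (Set.range w)).subtype hz
    rw [map_sum, map_zero] at h0
    have h1 : ∑ k, (z k : ℝ) • w k = 0 := by
      simp only [Int.cast_smul_eq_zsmul]
      simpa using h0
    exact_mod_cast Fintype.linearIndependent_iff.1 hw _ h1 k
  have hsp : ⊤ ≤ Submodule.span ℤ (Set.range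
      (fun k => (⟨w k, hmem k⟩ : AddSubgroup.closure (Set.range w)))) := by
    rintro ⟨x, hx⟩ -
    obtain ⟨z, hz⟩ := AddSubgroup.exists_of_mem_closure_range _ _ hx
    refine (Submodule.mem_span_range_iff_exists_fun ℤ).2 ⟨z, Subtype.ext ?_⟩
    refine Eq.trans ?_ hz.symm
    rw [AddSubgroup.val_finsetSum]
    rfl
  refine ⟨Module.Basis.mk hli hsp, s, ?_⟩
  simp only [Module.Basis.mk_apply]

/-! ### The fan of a Fujiki–Oka resolution -/

theorem linearIndependent_single (n : ℕ) :
    LinearIndependent ℝ (fun j : Fin n => (Pi.single j 1 : Fin n → ℝ)) := by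
  rw [Fintype.linearIndependent_iff]
  intro s hs k
  have := congrFun hs k
  simpa [Pi.single_apply] using this

theorem okaCenter_single {n : ℕ} (r : ℤ) (a : Fin n → ℤ) :
    okaCenter r a (fun j => Pi.single j 1) = fun j => (a j : ℝ) / r := by
  funext k
  simp only [okaCenter, Pi.smul_apply, Finset.sum_apply, smul_eq_mul, Pi.single_apply, mul_ite,
    mul_one, mul_zero, Finset.sum_ite_eq, Finset.mem_univ, if_true]
  ring

theorem typeLattice_single {n : ℕ} (r : ℤ) (a : Fin n → ℤ) :
    typeLattice r a (fun j => Pi.single j 1) = cyclicLattice r a := by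
  rw [typeLattice, cyclicLattice, okaCenter_single, Set.union_singleton]

/-- The vectors spanning the rays of the fan of a Fujiki–Oka resolution. -/
def vertexVectors {n : ℕ} (r : ℤ) (a : Fin n → ℤ) (i : Fin n) (v : Fin n → Fin n → ℝ) :
    Set (Fin n → ℝ) :=
  {p | ∃ w, MaxCone i r a v w ∧ ∃ k, w k = p}

section

variable {n : ℕ} {r : ℤ} {a : Fin n → ℤ} {i : Fin n}

theorem isSmoothCone_of_mem_fujikiOkaFan (ha : IsReduced r a i)
    {τ : PointedCone ℝ (Fin n → ℝ)} (hτ : τ ∈ fujikiOkaFan r a i) :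
    IsSmoothCone (cyclicLattice r a) τ := by
  obtain ⟨w, hw, hf⟩ := hτ
  obtain ⟨s, rfl⟩ := exists_hull_image_of_isFaceOf hf
  rw [← typeLattice_single, ← hw.closure_range ha]
  exact isSmoothCone_hull_image (hw.linearIndependent ha (linearIndependent_single n)) s

theorem hull_singleton_mem_conesOfDim_one (ha : IsReduced r a i) {w : Fin n → Fin n → ℝ}
    (hw : MaxCone i r a (fun j => Pi.single j 1) w) (k : Fin n) :
    PointedCone.hull ℝ {w k} ∈ conesOfDim (fujikiOkaFan r a i) 1 := by
  have hli := hw.linearIndependent ha (linearIndependent_single n)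
  rw [← Set.image_singleton]
  refine ⟨⟨w, hw, isFaceOf_hull_image hli _⟩, ?_⟩
  rw [finrank_span_hull_image hli, Set.ncard_singleton]

theorem exists_eq_hull_singleton (ha : IsReduced r a i) {ρ : PointedCone ℝ (Fin n → ℝ)}
    (hρ : ρ ∈ conesOfDim (fujikiOkaFan r a i) 1) :
    ∃ p ∈ vertexVectors r a i (fun j => Pi.single j 1), ρ = PointedCone.hull ℝ {p} := by
  obtain ⟨⟨w, hw, hf⟩, hdim⟩ := hρ
  obtain ⟨s, rfl⟩ := exists_hull_image_of_isFaceOf hf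
  rw [finrank_span_hull_image (hw.linearIndependent ha (linearIndependent_single n)),
    Set.ncard_eq_one] at hdim
  obtain ⟨k, rfl⟩ := hdim
  exact ⟨w k, ⟨w, hw, k, rfl⟩, by rw [Set.image_singleton]⟩

theorem vertexVectors_subset_gen (ha : IsReduced r a i) :
    vertexVectors r a i (fun j => Pi.single j 1) ⊆
      gen (cyclicLattice r a) (fujikiOkaFan r a i) := by
  rintro _ ⟨w, hw, k, rfl⟩
  have hρ := hull_singleton_mem_conesOfDim_one ha hw k
  refine Set.mem_biUnion hρ.1 ⟨_, hρ, PointedCone.IsFaceOf.refl _, ?_⟩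
  rw [← typeLattice_single, ← hw.closure_range ha]
  exact isPrimitiveGenerator_of_basis (hw.linearIndependent ha (linearIndependent_single n)) k

theorem numSmoothMaxCones_fujikiOkaFan (ha : IsReduced r a i) :
    numSmoothMaxCones (cyclicLattice r a) (fujikiOkaFan r a i) =
      {w | MaxCone i r a (fun j => Pi.single j 1) w}.ncard := by
  have hinj : Set.InjOn (fun w => PointedCone.hull ℝ (Set.range w))
      {w | MaxCone i r a (fun j => Pi.single j 1) w} :=
    fun w hw w' hw' he => hw.eq_of_hull_eq hw' ha (linearIndependent_single n) he
  rw [numSmoothMaxCones, ← hinj.ncard_image]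
  congr 1
  ext τ
  constructor
  · rintro ⟨⟨⟨w, hw, hf⟩, hdim⟩, -⟩
    obtain ⟨s, rfl⟩ := exists_hull_image_of_isFaceOf hf
    rw [finrank_span_hull_image (hw.linearIndependent ha (linearIndependent_single n))] at hdim
    have hs : s = Set.univ := Set.eq_of_subset_of_ncard_le (Set.subset_univ s) (by simp [hdim])
    exact ⟨w, hw, by rw [hs, Set.image_univ]⟩
  · rintro ⟨w, hw, rfl⟩
    have hmem : PointedCone.hull ℝ (Set.range w) ∈ fujikiOkaFan r a i :=
      ⟨w, hw, PointedCone.IsFaceOf.refl _⟩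
    refine ⟨⟨hmem, ?_⟩, isSmoothCone_of_mem_fujikiOkaFan ha hmem⟩
    have h := finrank_span_hull_image
      (hw.linearIndependent ha (linearIndependent_single n)) Set.univ
    rw [Set.image_univ, Set.ncard_univ, Nat.card_eq_fintype_card, Fintype.card_fin] at h
    exact h

theorem sum_pos_of_mem_vertexVectors (ha : IsReduced r a i) {p : Fin n → ℝ}
    (hp : p ∈ vertexVectors r a i (fun j => Pi.single j 1)) : 0 < ∑ k, p k := by
  obtain ⟨w, hw, l, rfl⟩ := hp
  obtain ⟨t, ht, he⟩ := mem_hull_range.1 (hw.mem_hull ha l)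
  have hwt : w l = t := by
    rw [he]
    funext k
    simp [Pi.single_apply]
  rw [hwt]
  refine lt_of_le_of_ne (Finset.sum_nonneg fun k _ => ht k) fun h0 => ?_
  refine (hw.linearIndependent ha (linearIndependent_single n)).ne_zero l ?_
  rw [hwt]
  funext k
  exact (Finset.sum_eq_zero_iff_of_nonneg fun k _ => ht k).1 h0.symm k (Finset.mem_univ k)

/-- The vertices of the induced triangulation are the normalizations of the vectors spanning the
rays, and these vectors, being primitive, are determined by their rays. -/
theorem numVertices_fujikiOkaFan (ha : IsReduced r a i) :
    numVertices (fujikiOkaFan r a i) =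
      (vertexVectors r a i (fun j => Pi.single j 1)).ncard := by
  have hinj : Set.InjOn (fun p : Fin n → ℝ => (∑ k, p k)⁻¹ • p)
      (vertexVectors r a i (fun j => Pi.single j 1)) := by
    intro p hp q hq he
    have hp0 := sum_pos_of_mem_vertexVectors ha hp
    have hq0 := sum_pos_of_mem_vertexVectors ha hq
    obtain ⟨w, hw, k, rfl⟩ := hp
    obtain ⟨w', hw', k', rfl⟩ := hq
    refine eq_of_eq_smul_of_closure_eq (hw.linearIndependent ha (linearIndependent_single n))
      (hw'.linearIndependent ha (linearIndependent_single n))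
      ((hw.closure_range ha).trans (hw'.closure_range ha).symm)
      (t := (∑ l, w k l) * (∑ l, w' k' l)⁻¹) (by positivity) ?_
    dsimp only at he
    rw [mul_smul, ← he, smul_smul, mul_inv_cancel₀ hp0.ne', one_smul]
  rw [numVertices, ← hinj.ncard_image]
  congr 1
  ext x
  constructor
  · rintro ⟨ρ, hρ, hx, hsum⟩
    obtain ⟨p, hp, rfl⟩ := exists_eq_hull_singleton ha hρ
    obtain ⟨t, ht, rfl⟩ := mem_hull_singleton.1 hx
    refine ⟨p, hp, ?_⟩
    simp only [Pi.smul_apply, smul_eq_mul, ← Finset.mul_sum] at hsum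
    dsimp only
    rw [eq_inv_of_mul_eq_one_left hsum]
  · rintro ⟨p, hp, rfl⟩
    have hp0 := sum_pos_of_mem_vertexVectors ha hp
    obtain ⟨w, hw, k, rfl⟩ := hp
    refine ⟨_, hull_singleton_mem_conesOfDim_one ha hw k,
      mem_hull_singleton.2 ⟨_, (inv_pos.2 hp0).le, rfl⟩, ?_⟩
    simp only [Pi.smul_apply, smul_eq_mul, ← Finset.mul_sum]
    exact inv_mul_cancel₀ hp0.ne'

end

/-! ### Counting maximal cones and vertices in dimension three -/

/-- The number of maximal cones of the subdivision of a three-dimensional cone of type `a / r`,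
where `a` has the entry `1` at the index `i` and the entries `x` and `y` at the other two. The
denominators decrease, so that the first argument, which makes the recursion structural, is
irrelevant as long as `r ≤ n + 1`. -/
def maxConeCount : ℕ → ℤ → ℤ → ℤ → ℕ
  | 0, _, _, _ => 1
  | n + 1, r, x, y =>
    if r ≤ 1 then 1
    else 1 + (if x = 0 then 0 else maxConeCount n x (-r % x) (y % x)) +
      (if y = 0 then 0 else maxConeCount n y (x % y) (-r % y))

/-- If `(u, v, w)` spans a cone of type `(1, x, y) / r` with Oka center `c`, this maps coordinates
with respect to `(u, c, w)` to coordinates with respect to `(u, v, w)`. -/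
def coordChangeSnd (r x y : ℤ) (p : ℚ × ℚ × ℚ) : ℚ × ℚ × ℚ :=
  (p.1 + p.2.1 / r, p.2.1 * (x / r), p.2.2 + p.2.1 * (y / r))

/-- If `(u, v, w)` spans a cone of type `(1, x, y) / r` with Oka center `c`, this maps coordinates
with respect to `(u, v, c)` to coordinates with respect to `(u, v, w)`. -/
def coordChangeThd (r x y : ℤ) (p : ℚ × ℚ × ℚ) : ℚ × ℚ × ℚ :=
  (p.1 + p.2.2 / r, p.2.1 + p.2.2 * (x / r), p.2.2 * (y / r))

/-- The vectors spanning the rays of the subdivision of a cone of type `(1, x, y) / r`, in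
coordinates with respect to that cone. The first argument is as in `maxConeCount`. -/
def vertexCoords : ℕ → ℤ → ℤ → ℤ → Finset (ℚ × ℚ × ℚ)
  | 0, _, _, _ => {(1, 0, 0), (0, 1, 0), (0, 0, 1)}
  | n + 1, r, x, y =>
    if r ≤ 1 then {(1, 0, 0), (0, 1, 0), (0, 0, 1)}
    else {(1 / (r : ℚ), x / (r : ℚ), y / (r : ℚ)), (0, 1, 0), (0, 0, 1)} ∪
      (if x = 0 then ∅ else (vertexCoords n x (-r % x) (y % x)).image (coordChangeSnd r x y)) ∪
      (if y = 0 then ∅ else (vertexCoords n y (x % y) (-r % y)).image (coordChangeThd r x y))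

theorem maxCone_one_iff {n : ℕ} {i : Fin n} {a : Fin n → ℤ} {v w : Fin n → Fin n → ℝ} :
    MaxCone i 1 a v w ↔ w = v := by
  constructor
  · intro h
    cases h with
    | smooth => rfl
    | center _ _ _ hr => exact absurd hr (lt_irrefl _)
    | step _ _ _ _ _ hr => exact absurd hr (lt_irrefl _)
  · rintro rfl
    exact .smooth a w

theorem maxCone_iff {n : ℕ} {i : Fin n} {r : ℤ} (hr : 1 < r) {a : Fin n → ℤ}
    {v w : Fin n → Fin n → ℝ} :
    MaxCone i r a v w ↔ w = Function.update v i (okaCenter r a v) ∨ ∃ j, j ≠ i ∧ a j ≠ 0 ∧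
      MaxCone i (a j) (remainder r a j) (Function.update v j (okaCenter r a v)) w := by
  constructor
  · intro h
    cases h with
    | smooth => exact absurd hr (lt_irrefl _)
    | center => exact .inl rfl
    | step _ _ _ j _ _ hj ha hw => exact .inr ⟨j, hj, ha, hw⟩
  · rintro (rfl | ⟨j, hj, ha, hw⟩)
    · exact .center r a v hr
    · exact .step r a v j w hr hj ha hw

theorem vertexCoords_of_one {n : ℕ} {x y : ℤ} :
    vertexCoords n 1 x y = {(1, 0, 0), (0, 1, 0), (0, 0, 1)} := by
  cases n <;> simp [vertexCoords]

theorem forall_fin_three {i j k : Fin 3} (hij : i ≠ j) (hik : i ≠ k) (hjk : j ≠ k) (l : Fin 3) :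
    l = i ∨ l = j ∨ l = k := by
  revert i j k l; decide

theorem sum_fin_three {M : Type*} [AddCommMonoid M] {i j k : Fin 3} (hij : i ≠ j) (hik : i ≠ k)
    (hjk : j ≠ k) (f : Fin 3 → M) : ∑ l, f l = f i + f j + f k := by
  have h : (Finset.univ : Finset (Fin 3)) = {i, j, k} := by
    ext l
    simpa using forall_fin_three hij hik hjk l
  rw [h, Finset.sum_insert (by simp [hij, hik]), Finset.sum_pair hjk, add_assoc]

section

variable {i j k : Fin 3}

theorem maxCone_iff_fin_three (hij : i ≠ j) (hik : i ≠ k) (hjk : j ≠ k) {r : ℤ} (hr : 1 < r)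
    {a : Fin 3 → ℤ} {v w : Fin 3 → Fin 3 → ℝ} :
    MaxCone i r a v w ↔ w = Function.update v i (okaCenter r a v) ∨
      (a j ≠ 0 ∧
        MaxCone i (a j) (remainder r a j) (Function.update v j (okaCenter r a v)) w) ∨
      (a k ≠ 0 ∧
        MaxCone i (a k) (remainder r a k) (Function.update v k (okaCenter r a v)) w) := by
  rw [maxCone_iff hr]
  refine or_congr_right ⟨?_, ?_⟩
  · rintro ⟨l, hl, ha, hw⟩
    rcases forall_fin_three hij hik hjk l with rfl | rfl | rfl
    · exact absurd rfl hl
    · exact .inl ⟨ha, hw⟩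
    · exact .inr ⟨ha, hw⟩
  · rintro (⟨ha, hw⟩ | ⟨ha, hw⟩)
    · exact ⟨j, hij.symm, ha, hw⟩
    · exact ⟨k, hik.symm, ha, hw⟩

theorem encard_maxCone (hij : i ≠ j) (hik : i ≠ k) (hjk : j ≠ k) (n : ℕ) {r : ℤ}
    (hn : r ≤ n + 1) {a : Fin 3 → ℤ} (ha : IsReduced r a i) {v : Fin 3 → Fin 3 → ℝ}
    (hv : LinearIndependent ℝ v) :
    {w | MaxCone i r a v w}.encard = maxConeCount n r (a j) (a k) := by
  induction n generalizing r a v with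
  | zero =>
    obtain rfl : r = 1 := by have := ha.pos; push_cast at hn; omega
    simp [maxCone_one_iff, maxConeCount]
  | succ n ih =>
    rcases eq_or_ne r 1 with rfl | hr1
    · simp [maxCone_one_iff, maxConeCount]
    have hr : 1 < r := by have := ha.pos; omega
    set c := okaCenter r a v with hc
    have hset : {w | MaxCone i r a v w} = {Function.update v i c} ∪
        {w | a j ≠ 0 ∧ MaxCone i (a j) (remainder r a j) (Function.update v j c) w} ∪
        {w | a k ≠ 0 ∧ MaxCone i (a k) (remainder r a k) (Function.update v k c) w} := by
      ext w
      simp only [Set.mem_ofPred_eq, Set.mem_union, Set.mem_singleton_iff, or_assoc]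
      exact maxCone_iff_fin_three hij hik hjk hr
    have hpos : ∀ {l}, l ≠ i → a l ≠ 0 → 0 < a l := fun hl h => (ha.remainder hr hl h).pos
    have hsub : ∀ {l w}, l ≠ i → a l ≠ 0 →
        MaxCone i (a l) (remainder r a l) (Function.update v l c) w →
        openCone w ⊆ openCone (Function.update v l c) :=
      fun hl h hw => hw.openCone_subset (ha.remainder hr hl h)
    have hai : 0 < a i := by simp [ha.eq_one hr]
    have hcard : ∀ l l', (l = j ∧ l' = k) ∨ (l = k ∧ l' = j) →
        {w | a l ≠ 0 ∧ MaxCone i (a l) (remainder r a l) (Function.update v l c) w}.encard =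
          ((if a l = 0 then 0
            else maxConeCount n (a l) (remainder r a l j) (remainder r a l k) : ℕ) : ℕ∞) := by
      intro l l' hl
      have hli : l ≠ i := by rcases hl with h | h <;> simp [h.1, hij.symm, hik.symm]
      by_cases h0 : a l = 0
      · simp [h0]
      · simp only [ne_eq, h0, not_false_eq_true, true_and, if_false]
        refine ih ?_ (ha.remainder hr hli h0) (linearIndependent_update_okaCenter ha.pos.ne' hv h0)
        have := ha.lt l
        push_cast at hn
        omega
    rw [hset, Set.encard_union_eq, Set.encard_union_eq, Set.encard_singleton,
      hcard j k (.inl ⟨rfl, rfl⟩), hcard k j (.inr ⟨rfl, rfl⟩), maxConeCount, if_neg (not_le.2 hr)]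
    · simp [remainder, hjk, hjk.symm]
    · rw [Set.disjoint_left]
      rintro _ rfl ⟨h0, hw⟩
      exact not_disjoint_openCone_self _
        ((disjoint_openCone_update hv hij hai (hpos hij.symm h0)).mono_right (hsub hij.symm h0 hw))
    · rw [Set.disjoint_left]
      rintro w (rfl | ⟨h0', hw'⟩) ⟨h0, hw⟩
      · exact not_disjoint_openCone_self _
          ((disjoint_openCone_update hv hik hai (hpos hik.symm h0)).mono_right
            (hsub hik.symm h0 hw))
      · exact not_disjoint_openCone_self w
          ((disjoint_openCone_update hv hjk (hpos hij.symm h0') (hpos hik.symm h0)).mono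
            (hsub hij.symm h0' hw') (hsub hik.symm h0 hw))

/-- The vector with the given coordinates with respect to `(v i, v j, v k)`. -/
def ofCoords (v : Fin 3 → Fin 3 → ℝ) (i j k : Fin 3) (p : ℚ × ℚ × ℚ) : Fin 3 → ℝ :=
  (p.1 : ℝ) • v i + (p.2.1 : ℝ) • v j + (p.2.2 : ℝ) • v k

theorem ofCoords_injective (hij : i ≠ j) (hik : i ≠ k) (hjk : j ≠ k) {v : Fin 3 → Fin 3 → ℝ}
    (hv : LinearIndependent ℝ v) : Function.Injective (ofCoords v i j k) := by
  have h : ∀ p : ℚ × ℚ × ℚ, ofCoords v i j k p =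
      ∑ l, (if l = i then (p.1 : ℝ) else if l = j then (p.2.1 : ℝ) else p.2.2) • v l := fun p => by
    rw [sum_fin_three hij hik hjk]
    simp [ofCoords, hij.symm, hik.symm, hjk.symm]
  intro p q hpq
  rw [h, h] at hpq
  have h' := eq_of_sum_smul_eq hv hpq
  have h1 := congrFun h' i
  have h2 := congrFun h' j
  have h3 := congrFun h' k
  simp only [if_true, hij.symm, hik.symm, hjk.symm, if_false, Rat.cast_inj] at h1 h2 h3
  exact Prod.ext h1 (Prod.ext h2 h3)

theorem okaCenter_fin_three (hij : i ≠ j) (hik : i ≠ k) (hjk : j ≠ k) (r : ℤ)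
    {a : Fin 3 → ℤ} (ha : a i = 1) (v : Fin 3 → Fin 3 → ℝ) :
    okaCenter r a v = ofCoords v i j k (1 / (r : ℚ), a j / (r : ℚ), a k / (r : ℚ)) := by
  rw [okaCenter, sum_fin_three hij hik hjk, ha, ofCoords]
  push_cast
  simp only [smul_add, smul_smul]
  ring_nf

theorem vertexVectors_eq_image (hij : i ≠ j) (hik : i ≠ k) (hjk : j ≠ k) (n : ℕ) {r : ℤ}
    (hn : r ≤ n + 1) {a : Fin 3 → ℤ} (ha : IsReduced r a i) (v : Fin 3 → Fin 3 → ℝ) :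
    vertexVectors r a i v = ofCoords v i j k '' (vertexCoords n r (a j) (a k)) := by
  have hone : ∀ (n : ℕ) (a : Fin 3 → ℤ) (v : Fin 3 → Fin 3 → ℝ), vertexVectors 1 a i v =
      ofCoords v i j k '' (vertexCoords n 1 (a j) (a k)) := by
    intro n a v
    rw [vertexCoords_of_one]
    ext p
    simp only [vertexVectors, maxCone_one_iff, exists_eq_left, Set.mem_ofPred_eq,
      Finset.coe_insert, Finset.coe_singleton, Set.image_insert_eq, Set.image_singleton,
      Set.mem_insert_iff, Set.mem_singleton_iff]
    simp only [ofCoords, Rat.cast_one, Rat.cast_zero, one_smul, zero_smul, add_zero, zero_add]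
    constructor
    · rintro ⟨l, rfl⟩
      rcases forall_fin_three hij hik hjk l with rfl | rfl | rfl <;> simp
    · rintro (rfl | rfl | rfl) <;> exact ⟨_, rfl⟩
  induction n generalizing r a v with
  | zero =>
    obtain rfl : r = 1 := by have := ha.pos; push_cast at hn; omega
    exact hone 0 a v
  | succ n ih =>
    rcases eq_or_ne r 1 with rfl | hr1
    · exact hone _ a v
    have hr : 1 < r := by have := ha.pos; omega
    have hc := okaCenter_fin_three hij hik hjk r (ha.eq_one hr) v
    set c := okaCenter r a v
    have hset : vertexVectors r a i v = {c, v j, v k} ∪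
        {p | a j ≠ 0 ∧
          p ∈ vertexVectors (a j) (remainder r a j) i (Function.update v j c)} ∪
        {p | a k ≠ 0 ∧
          p ∈ vertexVectors (a k) (remainder r a k) i (Function.update v k c)} := by
      ext p
      simp only [vertexVectors, maxCone_iff_fin_three hij hik hjk hr, Set.mem_union,
        Set.mem_ofPred_eq, Set.mem_insert_iff, Set.mem_singleton_iff]
      constructor
      · rintro ⟨w, rfl | ⟨h0, hw⟩ | ⟨h0, hw⟩, l, rfl⟩
        · left; left
          rcases forall_fin_three hij hik hjk l with rfl | rfl | rfl
          · left; simp [c]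
          · right; left; simp [hij.symm]
          · right; right; simp [hik.symm]
        · exact .inl (.inr ⟨h0, w, hw, l, rfl⟩)
        · exact .inr ⟨h0, w, hw, l, rfl⟩
      · rintro (((rfl | rfl | rfl) | ⟨h0, w, hw, l, rfl⟩) | ⟨h0, w, hw, l, rfl⟩)
        · exact ⟨_, .inl rfl, i, by simp [c]⟩
        · exact ⟨_, .inl rfl, j, by simp [hij.symm]⟩
        · exact ⟨_, .inl rfl, k, by simp [hik.symm]⟩
        · exact ⟨w, .inr (.inl ⟨h0, hw⟩), l, rfl⟩
        · exact ⟨w, .inr (.inr ⟨h0, hw⟩), l, rfl⟩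
    have hj : {p | a j ≠ 0 ∧
          p ∈ vertexVectors (a j) (remainder r a j) i (Function.update v j c)} =
        ofCoords v i j k '' ((if a j = 0 then ∅ else (vertexCoords n (a j) (-r % a j)
          (a k % a j)).image (coordChangeSnd r (a j) (a k)) : Finset (ℚ × ℚ × ℚ)) :
            Set (ℚ × ℚ × ℚ)) := by
      by_cases h0 : a j = 0
      · simp [h0]
      · have hcomp : ofCoords (Function.update v j c) i j k =
            ofCoords v i j k ∘ coordChangeSnd r (a j) (a k) := by
          funext p
          simp only [ofCoords, coordChangeSnd, Function.comp, Function.update_self,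
            Function.update_of_ne hij, Function.update_of_ne hjk.symm, hc]
          push_cast
          module
        have hlt := ha.lt j
        rw [if_neg h0, Finset.coe_image, ← Set.image_comp, ← hcomp]
        simp only [ne_eq, h0, not_false_eq_true, true_and, Set.ofPred_mem_eq]
        rw [ih (by push_cast at hn; omega) (ha.remainder hr hij.symm h0)]
        simp [remainder, hjk.symm]
    have hk : {p | a k ≠ 0 ∧
          p ∈ vertexVectors (a k) (remainder r a k) i (Function.update v k c)} =
        ofCoords v i j k '' ((if a k = 0 then ∅ else (vertexCoords n (a k) (a j % a k)
          (-r % a k)).image (coordChangeThd r (a j) (a k)) : Finset (ℚ × ℚ × ℚ)) :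
            Set (ℚ × ℚ × ℚ)) := by
      by_cases h0 : a k = 0
      · simp [h0]
      · have hcomp : ofCoords (Function.update v k c) i j k =
            ofCoords v i j k ∘ coordChangeThd r (a j) (a k) := by
          funext p
          simp only [ofCoords, coordChangeThd, Function.comp, Function.update_self,
            Function.update_of_ne hik, Function.update_of_ne hjk, hc]
          push_cast
          module
        have hlt := ha.lt k
        rw [if_neg h0, Finset.coe_image, ← Set.image_comp, ← hcomp]
        simp only [ne_eq, h0, not_false_eq_true, true_and, Set.ofPred_mem_eq]
        rw [ih (by push_cast at hn; omega) (ha.remainder hr hik.symm h0)]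
        simp [remainder, hjk]
    rw [hset, hj, hk, vertexCoords, if_neg (not_le.2 hr), Finset.coe_union, Finset.coe_union,
      Set.image_union, Set.image_union]
    congr 2
    simp only [Finset.coe_insert, Finset.coe_singleton, Set.image_insert_eq, Set.image_singleton,
      ← hc]
    simp [ofCoords]

theorem ncard_vertexVectors (hij : i ≠ j) (hik : i ≠ k) (hjk : j ≠ k) (n : ℕ) {r : ℤ}
    (hn : r ≤ n + 1) {a : Fin 3 → ℤ} (ha : IsReduced r a i) {v : Fin 3 → Fin 3 → ℝ}
    (hv : LinearIndependent ℝ v) :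
    (vertexVectors r a i v).ncard = (vertexCoords n r (a j) (a k)).card := by
  rw [vertexVectors_eq_image hij hik hjk n hn ha v,
    Set.ncard_image_of_injective _ (ofCoords_injective hij hik hjk hv), Set.ncard_coe_finset]

end

theorem maxConeCount_nine : maxConeCount 8 9 4 7 = 23 := by decide +kernel

theorem maxConeCount_fourteen : maxConeCount 13 14 9 11 = 43 := by decide +kernel

theorem card_vertexCoords_nine : (vertexCoords 8 9 4 7).card = 14 := by decide +kernel

theorem card_vertexCoords_fourteen : (vertexCoords 13 14 9 11).card = 24 := by decide +kernel

/-! ### The Euler inequality -/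

/-- The weight of a vertex of a triangulation of the triangle, in barycentric coordinates up to a
positive factor: `2` in the interior, `1` inside an edge and `0` at the corners and outside. -/
def vertexWeight (p : ℚ × ℚ × ℚ) : ℕ :=
  if 0 ≤ p.1 ∧ 0 ≤ p.2.1 ∧ 0 ≤ p.2.2 then
    2 - ((if p.1 = 0 then 1 else 0) + (if p.2.1 = 0 then 1 else 0) + (if p.2.2 = 0 then 1 else 0))
  else 0

theorem vertexWeight_le_two (p : ℚ × ℚ × ℚ) : vertexWeight p ≤ 2 := by
  unfold vertexWeight
  split_ifs <;> omega

theorem vertexWeight_mul {s t : ℚ} (hs : 0 < s) (ht : 0 < t) (α β γ : ℚ) :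
    vertexWeight (α, s * β, t * γ) = vertexWeight (α, β, γ) := by
  simp only [vertexWeight, mul_nonneg_iff_of_pos_left hs, mul_nonneg_iff_of_pos_left ht,
    mul_eq_zero, hs.ne', ht.ne', false_or]

/-- The inverse of `coordChangeSnd`. -/
def coordChangeSndInv (r x y : ℤ) (p : ℚ × ℚ × ℚ) : ℚ × ℚ × ℚ :=
  (p.1 - p.2.1 / x, p.2.1 * (r / x), p.2.2 - p.2.1 * (y / x))

/-- The inverse of `coordChangeThd`. -/
def coordChangeThdInv (r x y : ℤ) (p : ℚ × ℚ × ℚ) : ℚ × ℚ × ℚ :=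
  (p.1 - p.2.2 / y, p.2.1 - p.2.2 * (x / y), p.2.2 * (r / y))

theorem coordChangeSndInv_leftInverse {r x : ℤ} (hr : r ≠ 0) (hx : x ≠ 0) (y : ℤ) :
    Function.LeftInverse (coordChangeSndInv r x y) (coordChangeSnd r x y) := by
  have hr' : (r : ℚ) ≠ 0 := by exact_mod_cast hr
  have hx' : (x : ℚ) ≠ 0 := by exact_mod_cast hx
  intro p
  refine Prod.ext ?_ (Prod.ext ?_ ?_) <;> simp only [coordChangeSnd, coordChangeSndInv] <;>
    field_simp <;> ring

theorem coordChangeThdInv_leftInverse {r y : ℤ} (hr : r ≠ 0) (x : ℤ) (hy : y ≠ 0) :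
    Function.LeftInverse (coordChangeThdInv r x y) (coordChangeThd r x y) := by
  have hr' : (r : ℚ) ≠ 0 := by exact_mod_cast hr
  have hy' : (y : ℚ) ≠ 0 := by exact_mod_cast hy
  intro p
  refine Prod.ext ?_ (Prod.ext ?_ ?_) <;> simp only [coordChangeThd, coordChangeThdInv] <;>
    field_simp <;> ring

theorem vertexWeight_sub_add_le (α b g : ℚ) :
    vertexWeight (α - b, b, g - b) + vertexWeight (α - g, b - g, g) ≤ vertexWeight (α, b, g) := by
  unfold vertexWeight
  rcases lt_trichotomy b g with h | h | h
  · grind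
  · grind
  · grind

theorem vertexWeight_sub_le (α b γ : ℚ) :
    vertexWeight (α - b, b, γ) ≤ vertexWeight (α, b, γ) := by
  unfold vertexWeight
  grind

theorem vertexWeight_swap (α β γ : ℚ) : vertexWeight (α, β, γ) = vertexWeight (α, γ, β) := by
  unfold vertexWeight
  grind

/-- Each vertex weighs at most as much in the new cones together as in the old one. -/
theorem vertexWeight_coordChange_le {r x y : ℤ} (hr : 0 < r) (hx : 0 ≤ x) (hy : 0 ≤ y)
    (p : ℚ × ℚ × ℚ) :
    (if x = 0 then 0 else vertexWeight (coordChangeSndInv r x y p)) +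
      (if y = 0 then 0 else vertexWeight (coordChangeThdInv r x y p)) ≤ vertexWeight p := by
  obtain ⟨α, β, γ⟩ := p
  have hr' : (0 : ℚ) < r := by exact_mod_cast hr
  rcases hx.eq_or_lt' with rfl | hx <;> rcases hy.eq_or_lt' with rfl | hy
  · simp
  · have hy' : (0 : ℚ) < y := by exact_mod_cast hy
    have h1 : coordChangeThdInv r 0 y (α, β, γ) = (α - γ / y, 1 * β, r * (γ / y)) := by
      refine Prod.ext rfl (Prod.ext ?_ ?_) <;> simp [coordChangeThdInv]
      ring
    have h2 : (α, β, γ) = (α, 1 * β, y * (γ / y)) := by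
      rw [one_mul, mul_div_cancel₀ _ hy'.ne']
    rw [h1, h2, if_pos rfl, if_neg hy.ne', zero_add, vertexWeight_mul one_pos hr',
      vertexWeight_mul one_pos hy', vertexWeight_swap, vertexWeight_swap α]
    exact vertexWeight_sub_le _ _ _
  · have hx' : (0 : ℚ) < x := by exact_mod_cast hx
    have h1 : coordChangeSndInv r x 0 (α, β, γ) = (α - β / x, r * (β / x), 1 * γ) := by
      refine Prod.ext rfl (Prod.ext ?_ ?_) <;> simp [coordChangeSndInv]
      ring
    have h2 : (α, β, γ) = (α, x * (β / x), 1 * γ) := by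
      rw [one_mul, mul_div_cancel₀ _ hx'.ne']
    rw [h1, h2, if_pos rfl, if_neg hx.ne', add_zero, vertexWeight_mul hr' one_pos,
      vertexWeight_mul hx' one_pos]
    exact vertexWeight_sub_le _ _ _
  · have hx' : (0 : ℚ) < x := by exact_mod_cast hx
    have hy' : (0 : ℚ) < y := by exact_mod_cast hy
    have h1 : coordChangeSndInv r x y (α, β, γ) =
        (α - β / x, r * (β / x), y * (γ / y - β / x)) := by
      refine Prod.ext rfl (Prod.ext ?_ ?_) <;> simp only [coordChangeSndInv] <;> field_simp
    have h2 : coordChangeThdInv r x y (α, β, γ) =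
        (α - γ / y, x * (β / x - γ / y), r * (γ / y)) := by
      refine Prod.ext rfl (Prod.ext ?_ ?_) <;> simp only [coordChangeThdInv] <;> field_simp
    have h3 : (α, β, γ) = (α, x * (β / x), y * (γ / y)) := by
      rw [mul_div_cancel₀ _ hx'.ne', mul_div_cancel₀ _ hy'.ne']
    rw [h1, h2, h3, if_neg hx.ne', if_neg hy.ne', vertexWeight_mul hr' hy',
      vertexWeight_mul hx' hr', vertexWeight_mul hx' hy']
    exact vertexWeight_sub_add_le _ _ _

theorem vertexWeight_center {r x y : ℤ} (hr : 0 < r) (hx : 0 ≤ x) (hy : 0 ≤ y) :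
    vertexWeight (1 / (r : ℚ), x / (r : ℚ), y / (r : ℚ)) =
      (if x = 0 then 0 else 1) + (if y = 0 then 0 else 1) := by
  have hr' : (0 : ℚ) < r := by exact_mod_cast hr
  have hx' : (0 : ℚ) ≤ x := by exact_mod_cast hx
  have hy' : (0 : ℚ) ≤ y := by exact_mod_cast hy
  have h : 0 ≤ (1 / (r : ℚ)) ∧ 0 ≤ x / (r : ℚ) ∧ 0 ≤ y / (r : ℚ) :=
    ⟨by positivity, by positivity, by positivity⟩
  simp only [vertexWeight, h, and_self, if_true, div_eq_zero_iff, hr'.ne', or_false, one_ne_zero,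
    if_false, Int.cast_eq_zero]
  split_ifs <;> rfl

theorem vertexWeight_center_coordChange {r x y : ℤ} (hr : 0 < r) :
    (if x = 0 then 0 else
        vertexWeight (coordChangeSndInv r x y (1 / (r : ℚ), x / (r : ℚ), y / (r : ℚ)))) +
      (if y = 0 then 0 else
        vertexWeight (coordChangeThdInv r x y (1 / (r : ℚ), x / (r : ℚ), y / (r : ℚ)))) = 0 := by
  have hr' : (r : ℚ) ≠ 0 := by exact_mod_cast hr.ne'
  have h1 : x ≠ 0 → coordChangeSndInv r x y (1 / (r : ℚ), x / (r : ℚ), y / (r : ℚ)) =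
      (0, 1, 0) := fun hx => by
    have hx' : (x : ℚ) ≠ 0 := by exact_mod_cast hx
    refine Prod.ext ?_ (Prod.ext ?_ ?_) <;> simp only [coordChangeSndInv] <;> field_simp <;> ring
  have h2 : y ≠ 0 → coordChangeThdInv r x y (1 / (r : ℚ), x / (r : ℚ), y / (r : ℚ)) =
      (0, 0, 1) := fun hy => by
    have hy' : (y : ℚ) ≠ 0 := by exact_mod_cast hy
    refine Prod.ext ?_ (Prod.ext ?_ ?_) <;> simp only [coordChangeThdInv] <;> field_simp <;> ring
  split_ifs with hx hy hy
  · rfl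
  · rw [h2 hy]; simp [vertexWeight]
  · rw [h1 hx]; simp [vertexWeight]
  · rw [h1 hx, h2 hy]; simp [vertexWeight]

/-- The number of cones is at most one more than the total weight of the vertices: a subdivision
step adds two cones if the center is interior and one if it lies on an edge, which is its weight.
Vertices that two new cones have on a common edge are interior in the old one. -/
theorem maxConeCount_le_sum_vertexWeight (n : ℕ) {r x y : ℤ} (hr : 0 < r) (hx : 0 ≤ x)
    (hy : 0 ≤ y) :
    maxConeCount n r x y ≤ 1 + ∑ p ∈ vertexCoords n r x y, vertexWeight p := by
  induction n generalizing r x y with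
  | zero => simp [maxConeCount]
  | succ n ih =>
    rcases eq_or_ne r 1 with rfl | hr1
    · simp [maxConeCount]
    have hr2 : ¬ r ≤ 1 := by omega
    set c : ℚ × ℚ × ℚ := (1 / (r : ℚ), x / (r : ℚ), y / (r : ℚ)) with hc
    set G := vertexCoords (n + 1) r x y with hG
    have hGdef : G = {c, (0, 1, 0), (0, 0, 1)} ∪
        (if x = 0 then ∅ else (vertexCoords n x (-r % x) (y % x)).image (coordChangeSnd r x y)) ∪
        (if y = 0 then ∅ else
          (vertexCoords n y (x % y) (-r % y)).image (coordChangeThd r x y)) := by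
      rw [hG, vertexCoords, if_neg hr2]
    have hcG : c ∈ G := by simp [hGdef]
    have hX : (if x = 0 then 0 else maxConeCount n x (-r % x) (y % x)) ≤
        (if x = 0 then 0 else 1) +
          ∑ p ∈ G, (if x = 0 then 0 else vertexWeight (coordChangeSndInv r x y p)) := by
      by_cases h0 : x = 0
      · simp [h0]
      · simp only [if_neg h0]
        refine (ih (by omega) (Int.emod_nonneg _ h0) (Int.emod_nonneg _ h0)).trans
          (Nat.add_le_add_left ?_ 1)
        have hinv := coordChangeSndInv_leftInverse hr.ne' h0 y
        calc ∑ p ∈ vertexCoords n x (-r % x) (y % x), vertexWeight p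
            = ∑ p ∈ (vertexCoords n x (-r % x) (y % x)).image (coordChangeSnd r x y),
                vertexWeight (coordChangeSndInv r x y p) := by
              rw [Finset.sum_image hinv.injective.injOn]
              exact Finset.sum_congr rfl fun p _ => by rw [hinv p]
          _ ≤ _ := Finset.sum_le_sum_of_subset fun p hp => by
              rw [hGdef, if_neg h0]
              exact Finset.mem_union_left _ (Finset.mem_union_right _ hp)
    have hY : (if y = 0 then 0 else maxConeCount n y (x % y) (-r % y)) ≤
        (if y = 0 then 0 else 1) +
          ∑ p ∈ G, (if y = 0 then 0 else vertexWeight (coordChangeThdInv r x y p)) := by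
      by_cases h0 : y = 0
      · simp [h0]
      · simp only [if_neg h0]
        refine (ih (by omega) (Int.emod_nonneg _ h0) (Int.emod_nonneg _ h0)).trans
          (Nat.add_le_add_left ?_ 1)
        have hinv := coordChangeThdInv_leftInverse hr.ne' x h0
        calc ∑ p ∈ vertexCoords n y (x % y) (-r % y), vertexWeight p
            = ∑ p ∈ (vertexCoords n y (x % y) (-r % y)).image (coordChangeThd r x y),
                vertexWeight (coordChangeThdInv r x y p) := by
              rw [Finset.sum_image hinv.injective.injOn]
              exact Finset.sum_congr rfl fun p _ => by rw [hinv p]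
          _ ≤ _ := Finset.sum_le_sum_of_subset fun p hp => by
              rw [hGdef, if_neg h0]
              exact Finset.mem_union_right _ hp
    -- The center is a corner of every new cone, so its whole weight accounts for the new cones.
    have hle : ∀ p ∈ G, (if x = 0 then 0 else vertexWeight (coordChangeSndInv r x y p)) +
        (if y = 0 then 0 else vertexWeight (coordChangeThdInv r x y p)) +
          (if p = c then (if x = 0 then 0 else 1) + (if y = 0 then 0 else 1) else 0) ≤
        vertexWeight p := by
      intro p _
      by_cases hpc : p = c
      · rw [if_pos hpc, hpc, vertexWeight_center_coordChange hr, vertexWeight_center hr hx hy,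
          zero_add]
      · rw [if_neg hpc, add_zero]
        exact vertexWeight_coordChange_le hr hx hy p
    have hsum := Finset.sum_le_sum hle
    rw [Finset.sum_add_distrib, Finset.sum_add_distrib, Finset.sum_ite_eq', if_pos hcG] at hsum
    rw [maxConeCount, if_neg hr2]
    omega

theorem snd_thd_mem_vertexCoords (n : ℕ) (r x y : ℤ) :
    (0, 1, 0) ∈ vertexCoords n r x y ∧ (0, 0, 1) ∈ vertexCoords n r x y := by
  cases n with
  | zero => simp [vertexCoords]
  | succ n => rw [vertexCoords]; split_ifs <;> simp

/-- If `r`, `x` and `y` have no common factor, that is, if the vertex with the entry `1` is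
primitive in `N`, then it survives in some maximal cone: otherwise the recursion would reach a type
`(1, 0, 0) / r` with `r > 1`. -/
theorem fst_mem_vertexCoords (n : ℕ) {r x y : ℤ} (hr : 0 < r) (hx : 0 ≤ x) (hy : 0 ≤ y)
    (h : ∀ d : ℤ, d ∣ r → d ∣ x → d ∣ y → d ∣ 1) : (1, 0, 0) ∈ vertexCoords n r x y := by
  induction n generalizing r x y with
  | zero => simp [vertexCoords]
  | succ n ih =>
    rcases eq_or_ne r 1 with rfl | hr1
    · simp [vertexCoords]
    have hr2 : ¬ r ≤ 1 := by omega
    rw [vertexCoords, if_neg hr2]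
    by_cases hx0 : x = 0
    · by_cases hy0 : y = 0
      · have := Int.le_of_dvd one_pos (h r dvd_rfl (by simp [hx0]) (by simp [hy0]))
        omega
      · refine Finset.mem_union_right _ ?_
        rw [if_neg hy0]
        refine Finset.mem_image.2 ⟨(1, 0, 0), ih (by omega) (Int.emod_nonneg _ hy0)
          (Int.emod_nonneg _ hy0) fun d h1 h2 h3 => h d ?_ ?_ h1, by simp [coordChangeThd]⟩
        · exact dvd_neg.1 ((EuclideanDomain.dvd_mod_iff h1).1 h3)
        · exact (EuclideanDomain.dvd_mod_iff h1).1 h2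
    · refine Finset.mem_union_left _ (Finset.mem_union_right _ ?_)
      rw [if_neg hx0]
      refine Finset.mem_image.2 ⟨(1, 0, 0), ih (by omega) (Int.emod_nonneg _ hx0)
        (Int.emod_nonneg _ hx0) fun d h1 h2 h3 => h d ?_ h1 ?_, by simp [coordChangeSnd]⟩
      · exact dvd_neg.1 ((EuclideanDomain.dvd_mod_iff h1).1 h2)
      · exact (EuclideanDomain.dvd_mod_iff h1).1 h3

/-- The consequence `F + 5 ≤ 2 V` of Euler's formula for a triangulated triangle with `F` triangles
and `V` vertices. -/
theorem maxConeCount_add_five_le (n : ℕ) {r x y : ℤ} (hr : 0 < r) (hx : 0 ≤ x) (hy : 0 ≤ y)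
    (h : ∀ d : ℤ, d ∣ r → d ∣ x → d ∣ y → d ∣ 1) :
    maxConeCount n r x y + 5 ≤ 2 * (vertexCoords n r x y).card := by
  have h1 := maxConeCount_le_sum_vertexWeight n hr hx hy
  have hsub : ({(1, 0, 0), (0, 1, 0), (0, 0, 1)} : Finset (ℚ × ℚ × ℚ)) ⊆
      vertexCoords n r x y := by
    rw [Finset.insert_subset_iff, Finset.insert_subset_iff, Finset.singleton_subset_iff]
    exact ⟨fst_mem_vertexCoords n hr hx hy h, snd_thd_mem_vertexCoords n r x y⟩
  have h2 : ∑ p ∈ ({(1, 0, 0), (0, 1, 0), (0, 0, 1)} : Finset (ℚ × ℚ × ℚ)), vertexWeight p = 0 := by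
    decide +kernel
  have h3 : ({(1, 0, 0), (0, 1, 0), (0, 0, 1)} : Finset (ℚ × ℚ × ℚ)).card = 3 := by
    decide +kernel
  have h4 := Finset.sum_sdiff (f := fun p => vertexWeight p) hsub
  have h5 := Finset.sum_le_card_nsmul (vertexCoords n r x y \ {(1, 0, 0), (0, 1, 0), (0, 0, 1)})
    (fun p => vertexWeight p) 2 fun p _ => vertexWeight_le_two p
  have h6 := Finset.card_sdiff_add_card_eq_card hsub
  rw [smul_eq_mul] at h5
  omega

/-! ### The Hilbert basis -/

theorem single_mem_cyclicLattice {n : ℕ} (r : ℤ) (a : Fin n → ℤ) (j : Fin n) :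
    (Pi.single j 1 : Fin n → ℝ) ∈ cyclicLattice r a :=
  AddSubgroup.subset_closure (.inl ⟨j, rfl⟩)

theorem mem_cyclicLattice {n : ℕ} {r : ℤ} {a : Fin n → ℤ} {x : Fin n → ℝ} :
    x ∈ cyclicLattice r a ↔
      ∃ (z : Fin n → ℤ) (s : ℤ), ∀ k, x k = z k + s * (a k / r) := by
  constructor
  swap
  · rintro ⟨z, s, h⟩
    have hx : x = ∑ k, (z k : ℝ) • (Pi.single k 1 : Fin n → ℝ) +
        (s : ℝ) • fun k => (a k : ℝ) / r := by
      funext k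
      simp [h, Pi.single_apply]
    rw [hx]
    exact add_mem (sum_mem fun k _ => intCast_smul_mem _ (single_mem_cyclicLattice r a k))
      (intCast_smul_mem _ (AddSubgroup.subset_closure (.inr rfl)))
  intro hx
  induction hx using AddSubgroup.closure_induction with
  | mem x hx =>
    rcases hx with ⟨j, rfl⟩ | rfl
    · refine ⟨Pi.single j 1, 0, fun k => ?_⟩
      by_cases h : k = j
      · subst h; simp
      · simp [h]
    · exact ⟨0, 1, fun k => by simp⟩
  | zero => exact ⟨0, 0, by simp⟩
  | add x y _ _ hx hy =>
    obtain ⟨z, s, h⟩ := hx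
    obtain ⟨z', s', h'⟩ := hy
    refine ⟨z + z', s + s', fun k => ?_⟩
    rw [Pi.add_apply, h, h', Pi.add_apply]
    push_cast
    ring
  | neg x _ hx =>
    obtain ⟨z, s, h⟩ := hx
    refine ⟨-z, -s, fun k => ?_⟩
    rw [Pi.neg_apply, h, Pi.neg_apply]
    push_cast
    ring

/-- An element of the Hilbert basis other than a standard basis vector lies in the half-open unit
cube, and so is one of the `r - 1` nonzero representatives of `N / ℤⁿ`. -/
theorem hilbertBasis_subset {n : ℕ} {r : ℤ} (hr : 0 < r) (a : Fin n → ℤ) :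
    hilbertBasis (cyclicLattice r a) (PointedCone.positive ℝ (Fin n → ℝ)) ⊆
      Set.range (fun j => (Pi.single j 1 : Fin n → ℝ)) ∪
        (fun (s : ℤ) k => Int.fract ((s : ℝ) * (a k / r))) '' Set.Ico 1 r := by
  rintro x ⟨⟨hxσ, hxN, hx0⟩, hirr⟩
  rw [PointedCone.mem_positive] at hxσ
  have hr' : (r : ℝ) ≠ 0 := by exact_mod_cast hr.ne'
  by_cases h : ∃ j, 1 ≤ x j
  · obtain ⟨j, hj⟩ := h
    left
    refine ⟨j, ?_⟩
    by_contra hne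
    refine hirr ⟨Pi.single j 1, x - Pi.single j 1, ⟨?_, single_mem_cyclicLattice r a j, ?_⟩,
      ⟨?_, sub_mem hxN (single_mem_cyclicLattice r a j), fun h0 => hne ?_⟩, ?_⟩
    · rw [PointedCone.mem_positive]
      exact Pi.single_nonneg.2 zero_le_one
    · simp
    · rw [PointedCone.mem_positive]
      intro k
      by_cases hk : k = j
      · subst hk; simpa using hj
      · simpa [hk] using hxσ k
    · exact (sub_eq_zero.1 h0).symm
    · abel
  · push Not at h
    obtain ⟨z, s, hz⟩ := mem_cyclicLattice.1 hxN
    have hx : ∀ k, x k = Int.fract (((s % r : ℤ) : ℝ) * (a k / r)) := fun k => by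
      rw [eq_comm, Int.fract_eq_iff]
      refine ⟨hxσ k, h k, -z k - s / r * a k, ?_⟩
      rw [hz k, Int.emod_def]
      push_cast
      field_simp
      ring
    right
    refine ⟨s % r, ⟨?_, Int.emod_lt_of_pos _ hr⟩, (funext hx).symm⟩
    refine Int.add_one_le_of_lt (lt_of_le_of_ne (Int.emod_nonneg _ hr.ne') fun h0 => hx0 ?_)
    funext k
    rw [hx k, ← h0]
    simp

/-- The Hilbert basis in dimension `n + 1` has at most `r + n` elements: `n + 1` standard basis
vectors and `r - 1` others. -/
theorem encard_hilbertBasis_le {n : ℕ} {r : ℤ} (hr : 0 < r) (a : Fin (n + 1) → ℤ) :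
    (hilbertBasis (cyclicLattice r a) (PointedCone.positive ℝ (Fin (n + 1) → ℝ))).encard ≤
      ((r.toNat + n : ℕ) : ℕ∞) := by
  refine (Set.encard_le_encard (hilbertBasis_subset hr a)).trans
    ((Set.encard_union_le _ _).trans ?_)
  have h1 : (Set.range (fun j => (Pi.single j 1 : Fin (n + 1) → ℝ))).encard ≤ (n + 1 : ℕ) := by
    rw [← Set.image_univ]
    refine (Set.encard_image_le _ _).trans ?_
    simp
  have h2 : ((fun (s : ℤ) k => Int.fract ((s : ℝ) * (a k / r))) '' Set.Ico 1 r).encard ≤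
      ((r - 1).toNat : ℕ) := by
    refine (Set.encard_image_le _ _).trans ?_
    rw [← Finset.coe_Ico, Set.encard_coe_eq_coe_finsetCard, Int.card_Ico]
  refine (add_le_add h1 h2).trans ?_
  rw [← Nat.cast_add, Nat.cast_le]
  omega

/-! ### Generators of the group -/

theorem coe_diagElement_zpow {n : ℕ} (r : ℤ) (a : Fin n → ℤ) (m : ℤ) :
    (diagElement r a ^ m).val =
      Matrix.diagonal fun j => Complex.exp (2 * Real.pi * Complex.I * (m * (a j / r))) := by
  have hdiag : ∀ m : ℕ, (diagElement r a ^ m).val =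
      Matrix.diagonal fun j => Complex.exp (2 * Real.pi * Complex.I * (m * (a j / r))) := by
    intro m
    rw [Units.val_pow_eq_pow_val, diagElement, Matrix.diagonal_pow]
    congr 1
    funext j
    rw [Pi.pow_apply, ← Complex.exp_nat_mul]
    congr 1
    ring
  cases m with
  | ofNat m => simp [hdiag]
  | negSucc m =>
    rw [zpow_negSucc, Matrix.coe_units_inv, hdiag]
    refine Matrix.inv_eq_left_inv ?_
    rw [Matrix.diagonal_mul_diagonal, ← Matrix.diagonal_one]
    congr 1
    funext j
    rw [← Complex.exp_add, ← Complex.exp_zero]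
    congr 1
    push_cast
    ring

theorem exists_int_of_diagElement_eq_zpow {n : ℕ} {r m : ℤ} {a g : Fin n → ℤ} {s : ℤ}
    (h : diagElement r a = diagElement m g ^ s) (j : Fin n) :
    ∃ z : ℤ, (a j : ℝ) / r = z + s * (g j / m) := by
  have h1 : (diagElement r a ^ (1 : ℤ)).val j j = (diagElement m g ^ s).val j j := by
    rw [zpow_one, h]
  rw [coe_diagElement_zpow, coe_diagElement_zpow, Matrix.diagonal_apply_eq,
    Matrix.diagonal_apply_eq, Complex.exp_eq_exp_iff_exists_int] at h1
  obtain ⟨z, hz⟩ := h1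
  refine ⟨z, ?_⟩
  have h2 : (2 * Real.pi * Complex.I) * ((a j : ℂ) / r) =
      (2 * Real.pi * Complex.I) * (z + s * (g j / m)) := by
    rw [mul_add, mul_comm _ (z : ℂ), add_comm, ← hz]
    push_cast
    ring
  have h3 := mul_left_cancel₀ Complex.two_pi_I_ne_zero h2
  exact_mod_cast h3

theorem orderOf_diagElement {n : ℕ} {m : ℤ} (hm : 0 < m) {g : Fin n → ℤ} {j : Fin n}
    (hg : g j = 1) : orderOf (diagElement m g) = m.toNat := by
  have hmc : (m : ℂ) ≠ 0 := by exact_mod_cast hm.ne'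
  refine Nat.dvd_antisymm (orderOf_dvd_of_pow_eq_one ?_) ?_
  · rw [← zpow_natCast, Int.toNat_of_nonneg hm.le]
    refine Units.ext ?_
    rw [coe_diagElement_zpow, Units.val_one, ← Matrix.diagonal_one]
    congr 1
    funext k
    refine Complex.exp_eq_one_iff.2 ⟨g k, ?_⟩
    field_simp
  · have h := congrArg (fun A => A.val j j) (pow_orderOf_eq_one (diagElement m g))
    rw [← zpow_natCast, coe_diagElement_zpow, Matrix.diagonal_apply_eq, Units.val_one,
      Matrix.one_apply_eq, Complex.exp_eq_one_iff, hg] at h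
    obtain ⟨z, hz⟩ := h
    rw [mul_comm (z : ℂ)] at hz
    have h1 := mul_left_cancel₀ Complex.two_pi_I_ne_zero hz
    have h2 : (orderOf (diagElement m g) : ℤ) = m * z := by
      push_cast at h1
      field_simp at h1
      exact_mod_cast h1
    rw [← Int.natCast_dvd_natCast, Int.toNat_of_nonneg hm.le, h2]
    exact dvd_mul_right m z

theorem card_cyclicGroup {n : ℕ} {m : ℤ} (hm : 0 < m) {g : Fin n → ℤ} {j : Fin n}
    (hg : g j = 1) : Nat.card (cyclicGroup m g) = m.toNat := by
  rw [cyclicGroup, Nat.card_zpowers, orderOf_diagElement hm hg]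

theorem cyclicLattice_le_of_cyclicGroup_le {n : ℕ} {r m : ℤ} {a g : Fin n → ℤ}
    (h : cyclicGroup r a ≤ cyclicGroup m g) : cyclicLattice r a ≤ cyclicLattice m g := by
  obtain ⟨s, hs⟩ := Subgroup.mem_zpowers_iff.1 (h (Subgroup.mem_zpowers (diagElement r a)))
  choose z hz using exists_int_of_diagElement_eq_zpow hs.symm
  refine (AddSubgroup.closure_le _).2 ?_
  rintro _ (⟨j, rfl⟩ | rfl)
  · exact single_mem_cyclicLattice m g j
  · exact mem_cyclicLattice.2 ⟨z, s, hz⟩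

/-- The semi-unimodular generators of `(1/m)(g₁, …, gₙ)` have denominator `m`, and their numerators
are the residues of a multiple of `g`. -/
theorem exists_eq_mul_emod {n : ℕ} {r m : ℤ} {a g : Fin n → ℤ} {i j : Fin n} (hm : 0 < m)
    (hg : g j = 1) (ha : IsSemiUnimodular r a i) (h : cyclicGroup r a = cyclicGroup m g) :
    r = m ∧ ∃ s : ℤ, ∀ k, a k = s * g k % m := by
  have hr := zero_lt_one.trans ha.one_lt
  have hrm : r = m := by
    have h1 := card_cyclicGroup hr ha.2
    rw [h, card_cyclicGroup hm hg] at h1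
    omega
  subst hrm
  have hmem := Subgroup.mem_zpowers (diagElement r a)
  rw [← cyclicGroup, h] at hmem
  obtain ⟨s, hs⟩ := Subgroup.mem_zpowers_iff.1 hmem
  refine ⟨rfl, s, fun k => ?_⟩
  obtain ⟨z, hz⟩ := exists_int_of_diagElement_eq_zpow hs.symm k
  have hr' : (r : ℝ) ≠ 0 := by exact_mod_cast hr.ne'
  have h1 : (a k : ℝ) = z * r + s * g k := by
    field_simp at hz
    linarith
  have h2 : a k = z * r + s * g k := by exact_mod_cast h1
  rw [← Int.emod_eq_of_lt (ha.1 k).1 (ha.1 k).2, h2, Int.mul_add_emod_self_right]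

/-! ### Bounds for the number of maximal cones -/

theorem maxConeCount_succ (n : ℕ) {r : ℤ} (hr : 1 < r) (x y : ℤ) :
    (maxConeCount (n + 1) r x y : ℤ) =
      1 + (if x = 0 then 0 else (maxConeCount n x (-r % x) (y % x) : ℤ)) +
        (if y = 0 then 0 else (maxConeCount n y (x % y) (-r % y) : ℤ)) := by
  rw [maxConeCount, if_neg (not_le.2 hr)]
  push_cast
  rfl

theorem emod_eq_of_eq_add_mul {b c m q : ℤ} (h : b = c + m * q) (h0 : 0 ≤ c) (hc : c < m) :
    b % m = c := by
  rw [h, Int.add_mul_emod_self_left, Int.emod_eq_of_lt h0 hc]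

theorem dvd_emod_add_emod_add {m b c e : ℤ} (h : m ∣ b + c + e) : m ∣ b % m + c % m + e := by
  obtain ⟨q, hq⟩ := h
  refine ⟨q - b / m - c / m, ?_⟩
  rw [Int.emod_def, Int.emod_def]
  linear_combination hq

/-- If `1 + x + y` is divisible by `r`, then the quotient is Gorenstein, the subdivision is crepant,
and the number of its cones is the order of the group. -/
theorem maxConeCount_of_dvd_add_one (n : ℕ) {r x y : ℤ} (hn : r ≤ n + 1) (hr : 0 < r)
    (hx : 0 ≤ x) (hxr : x < r) (hy : 0 ≤ y) (hyr : y < r) (h : r ∣ x + y + 1) :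
    (maxConeCount n r x y : ℤ) = r := by
  induction n generalizing r x y with
  | zero => push_cast at hn; simp only [maxConeCount]; push_cast; omega
  | succ n ih =>
    rcases eq_or_ne r 1 with rfl | hr1
    · simp [maxConeCount]
    obtain ⟨q, hq⟩ := h
    obtain rfl : q = 1 := by
      have h1 : 0 < q := by by_contra hq0; nlinarith
      have h2 : q < 2 := by by_contra hq2; nlinarith
      omega
    push_cast at hn
    have hX : (if x = 0 then 0 else (maxConeCount n x (-r % x) (y % x) : ℤ)) = x := by
      split_ifs with h0
      · exact h0.symm
      · have hx0 : 0 < x := by omega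
        exact ih (by omega) hx0 (Int.emod_nonneg _ h0) (Int.emod_lt_of_pos _ hx0)
          (Int.emod_nonneg _ h0) (Int.emod_lt_of_pos _ hx0)
          (dvd_emod_add_emod_add ⟨-1, by linarith⟩)
    have hY : (if y = 0 then 0 else (maxConeCount n y (x % y) (-r % y) : ℤ)) = y := by
      split_ifs with h0
      · exact h0.symm
      · have hy0 : 0 < y := by omega
        exact ih (by omega) hy0 (Int.emod_nonneg _ h0) (Int.emod_lt_of_pos _ hy0)
          (Int.emod_nonneg _ h0) (Int.emod_lt_of_pos _ hy0)
          (dvd_emod_add_emod_add ⟨-1, by linarith⟩)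
    rw [maxConeCount_succ n (by omega), hX, hY]
    linarith

/-- The property `r ∣ x + y + 2` passes to the remainders when `x + y + 2 = r`; otherwise
`x + y + 2 = 2 r`, and the remainders are Gorenstein. -/
theorem le_two_mul_maxConeCount_of_dvd_add_two (n : ℕ) {r x y : ℤ} (hn : r ≤ n + 1) (hr : 0 < r)
    (hx : 0 ≤ x) (hxr : x < r) (hy : 0 ≤ y) (hyr : y < r) (h : r ∣ x + y + 2) :
    r ≤ 2 * (maxConeCount n r x y : ℤ) := by
  induction n generalizing r x y with
  | zero => push_cast at hn; simp only [maxConeCount]; push_cast; omega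
  | succ n ih =>
    rcases eq_or_ne r 1 with rfl | hr1
    · simp [maxConeCount]
    obtain ⟨q, hq⟩ := h
    have hq12 : q = 1 ∨ q = 2 := by
      have h1 : 0 < q := by by_contra hq0; nlinarith
      have h2 : q < 3 := by by_contra hq2; nlinarith
      omega
    push_cast at hn
    rw [maxConeCount_succ n (by omega)]
    rcases hq12 with rfl | rfl
    · have hX : x ≤ 2 * (if x = 0 then 0 else (maxConeCount n x (-r % x) (y % x) : ℤ)) := by
        split_ifs with h0
        · omega
        · have hx0 : 0 < x := by omega
          exact ih (by omega) hx0 (Int.emod_nonneg _ h0) (Int.emod_lt_of_pos _ hx0)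
            (Int.emod_nonneg _ h0) (Int.emod_lt_of_pos _ hx0)
            (dvd_emod_add_emod_add ⟨-1, by linarith⟩)
      have hY : y ≤ 2 * (if y = 0 then 0 else (maxConeCount n y (x % y) (-r % y) : ℤ)) := by
        split_ifs with h0
        · omega
        · have hy0 : 0 < y := by omega
          exact ih (by omega) hy0 (Int.emod_nonneg _ h0) (Int.emod_lt_of_pos _ hy0)
            (Int.emod_nonneg _ h0) (Int.emod_lt_of_pos _ hy0)
            (dvd_emod_add_emod_add ⟨-1, by linarith⟩)
      linarith
    · -- Here `x = y = r - 1`, and both remainders are Gorenstein.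
      obtain rfl : x = r - 1 := by omega
      obtain rfl : y = r - 1 := by omega
      have h0 : r - 1 ≠ 0 := by omega
      have h1 : 0 < r - 1 := by omega
      rw [if_neg h0, if_neg h0,
        maxConeCount_of_dvd_add_one n (by omega) h1 (Int.emod_nonneg _ h0)
          (Int.emod_lt_of_pos _ h1) (Int.emod_nonneg _ h0) (Int.emod_lt_of_pos _ h1)
          (dvd_emod_add_emod_add ⟨0, by ring⟩),
        maxConeCount_of_dvd_add_one n (by omega) h1 (Int.emod_nonneg _ h0)
          (Int.emod_lt_of_pos _ h1) (Int.emod_nonneg _ h0) (Int.emod_lt_of_pos _ h1)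
          (dvd_emod_add_emod_add ⟨0, by ring⟩)]
      omega

/-- The first remainder of `(1, r - 1, y) / r` is `(1, r - 2, y) / (r - 1)` as long as
`y < r - 1`, and the second one is Gorenstein. -/
theorem maxConeCount_sub_one (n : ℕ) {r y : ℤ} (hn : r ≤ n + 1) (hy : 0 < y) (hyr : y < r) :
    (maxConeCount n r (r - 1) y : ℤ) = (r - 1 - y) * (1 + y) + 2 * y + 1 := by
  induction n generalizing r with
  | zero => push_cast at hn; omega
  | succ n ih =>
    push_cast at hn
    rw [maxConeCount_succ n (by omega), if_neg (by omega), if_neg hy.ne',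
      maxConeCount_of_dvd_add_one n (by omega) hy (Int.emod_nonneg _ hy.ne')
        (Int.emod_lt_of_pos _ hy) (Int.emod_nonneg _ hy.ne') (Int.emod_lt_of_pos _ hy)
        (dvd_emod_add_emod_add ⟨0, by ring⟩)]
    have h1 : 0 < r - 1 := by omega
    rcases (show y ≤ r - 1 by omega).eq_or_lt with he | hlt
    · rw [maxConeCount_of_dvd_add_one n (by omega) h1 (Int.emod_nonneg _ h1.ne')
        (Int.emod_lt_of_pos _ h1) (Int.emod_nonneg _ h1.ne') (Int.emod_lt_of_pos _ h1)
        (dvd_emod_add_emod_add ⟨0, by linarith⟩), ← he]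
      ring
    · rw [emod_eq_of_eq_add_mul (b := -r) (c := r - 1 - 1) (q := -2) (by ring) (by omega)
        (by omega), Int.emod_eq_of_lt hy.le hlt, ih (by omega) hlt]
      ring

/-- The second remainder of `(1, 2k + 1, s - 2) / s` is `(1, 2k + 1, s - 4) / (s - 2)` as long as
`s > 2k + 3`, and the first one, of denominator `2k + 1`, contributes at least `k + 1` cones. -/
theorem le_maxConeCount_even (n : ℕ) {k : ℤ} (hk : 0 < k) (u : ℕ) (hu : (u : ℤ) + 1 ≤ k)
    (hn : 2 * k + 2 + 2 * u ≤ n + 1) :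
    u * (k + 2) + 6 * k + 2 ≤
      (maxConeCount n (2 * k + 2 + 2 * u) (2 * k + 1) (2 * k + 2 * u) : ℤ) := by
  induction u generalizing n with
  | zero =>
    have h := maxConeCount_sub_one n (r := 2 * k + 2) (y := 2 * k) (by push_cast at hn; omega)
      (by omega) (by omega)
    rw [show 2 * k + 2 - 1 = 2 * k + 1 by ring] at h
    simp only [Nat.cast_zero, mul_zero, add_zero, h]
    linarith
  | succ u ih =>
    push_cast at hn hu ⊢
    obtain ⟨n, rfl⟩ : ∃ n', n = n' + 1 := ⟨n - 1, by omega⟩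
    push_cast at hn
    have h1 : (0 : ℤ) < 2 * k + 1 := by omega
    have hX := le_two_mul_maxConeCount_of_dvd_add_two n
      (x := -(2 * k + 2 + 2 * (u + 1)) % (2 * k + 1)) (y := (2 * k + 2 * (u + 1)) % (2 * k + 1))
      (by omega) h1 (Int.emod_nonneg _ h1.ne') (Int.emod_lt_of_pos _ h1)
      (Int.emod_nonneg _ h1.ne') (Int.emod_lt_of_pos _ h1) (dvd_emod_add_emod_add ⟨0, by ring⟩)
    have hY := ih n (by omega) (by omega)
    rw [show 2 * k + 2 + 2 * (u : ℤ) = 2 * k + 2 * (u + 1) by ring] at hY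
    have he : -(2 * k + 2 + 2 * ((u : ℤ) + 1)) % (2 * k + 2 * (u + 1)) = 2 * k + 2 * u :=
      emod_eq_of_eq_add_mul (q := -2) (by ring) (by omega) (by omega)
    rw [maxConeCount_succ n (by omega), if_neg h1.ne', if_neg (by omega), he,
      Int.emod_eq_of_lt (a := 2 * k + 1) (by omega) (by omega)]
    linarith [show k + 1 ≤ (maxConeCount n (2 * k + 1) (-(2 * k + 2 + 2 * ((u : ℤ) + 1)) %
      (2 * k + 1)) ((2 * k + 2 * ((u : ℤ) + 1)) % (2 * k + 1)) : ℤ) by omega]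

theorem two_mul_le_maxConeCount_sub_one (n : ℕ) {r y : ℤ} (hn : r ≤ n + 1) (hy : 2 ≤ y)
    (hyr : y + 2 ≤ r) : 2 * r ≤ (maxConeCount n r (r - 1) y : ℤ) := by
  rw [maxConeCount_sub_one n hn (by omega) (by omega)]
  nlinarith

theorem two_mul_le_maxConeCount_four_mul (n : ℕ) {k : ℤ} (hn : 4 * k ≤ n + 1) (hk : 2 ≤ k) :
    2 * (4 * k) ≤ (maxConeCount n (4 * k) (2 * k + 1) (4 * k - 2) : ℤ) := by
  obtain ⟨u, hu⟩ : ∃ u : ℕ, (u : ℤ) + 1 = k := ⟨(k - 1).toNat, by omega⟩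
  have h := le_maxConeCount_even n (by omega) u hu.le (by omega)
  rw [show 2 * k + 2 + 2 * (u : ℤ) = 4 * k by linarith,
    show 2 * k + 2 * (u : ℤ) = 4 * k - 2 by linarith, show (u : ℤ) = k - 1 by linarith] at h
  nlinarith

/-! ### Semi-unimodular generators of the four groups -/

/-- The semi-unimodular generators of `(1 / dr)(1, dr - 1, ad)` are its multiples by `1` and
`-1`. -/
theorem numerators_sub_one {d r a : ℤ} {b : Fin 3 → ℤ} {i : Fin 3} {s : ℤ} (hd : 1 < d) (ha : 0 < a)
    (har : a < r) (hi : b i = 1)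
    (hb : ∀ l, b l = s * (![1, d * r - 1, a * d] : Fin 3 → ℤ) l % (d * r)) :
    ∃ j k, i ≠ j ∧ i ≠ k ∧ j ≠ k ∧ b j = d * r - 1 ∧ 2 ≤ b k ∧ b k + 2 ≤ d * r := by
  have h0 := hb 0
  have h1 := hb 1
  have h2 := hb 2
  simp only [Matrix.cons_val] at h0 h1 h2
  have had : 2 ≤ a * d := by nlinarith
  have hrad : a * d + 2 ≤ d * r := by nlinarith
  fin_cases i
  · change b 0 = 1 at hi
    rw [h0] at hi
    have hq := Int.emod_add_mul_ediv (s * 1) (d * r)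
    rw [hi] at hq
    refine ⟨1, 2, by decide, by decide, by decide, ?_, ?_⟩
    · rw [h1, emod_eq_of_eq_add_mul (c := d * r - 1) (q := s * 1 / (d * r) * (d * r - 1))
        (by linear_combination -(d * r - 1) * hq) (by omega) (by omega)]
    · rw [h2, emod_eq_of_eq_add_mul (c := a * d) (q := s * 1 / (d * r) * (a * d))
        (by linear_combination -(a * d) * hq) (by omega) (by omega)]
      omega
  · change b 1 = 1 at hi
    rw [h1] at hi
    have hq := Int.emod_add_mul_ediv (s * (d * r - 1)) (d * r)
    rw [hi] at hq
    set q := s * (d * r - 1) / (d * r)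
    refine ⟨0, 2, by decide, by decide, by decide, ?_, ?_⟩
    · rw [h0, emod_eq_of_eq_add_mul (c := d * r - 1) (q := s - q - 1)
        (by linear_combination hq) (by omega) (by omega)]
    · rw [h2, emod_eq_of_eq_add_mul (c := d * r - a * d) (q := (s - q) * (a * d) - 1)
        (by linear_combination (a * d) * hq) (by omega) (by omega)]
      omega
  · -- The third entry of every multiple is divisible by `d`.
    change b 2 = 1 at hi
    rw [h2] at hi
    have hq := Int.emod_add_mul_ediv (s * (a * d)) (d * r)
    rw [hi] at hq
    have : d ∣ 1 := ⟨s * a - r * (s * (a * d) / (d * r)), by linear_combination hq⟩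
    have := Int.le_of_dvd one_pos this
    omega

/-- The semi-unimodular generators of `(1 / 4t)(1, 2t + 1, 4t - 2)` are its multiples by `1` and
`2t + 1`. -/
theorem numerators_four_mul {t : ℤ} {b : Fin 3 → ℤ} {i : Fin 3} {s : ℤ} (ht : 2 ≤ t) (hi : b i = 1)
    (hb : ∀ l, b l = s * (![1, 2 * t + 1, 4 * t - 2] : Fin 3 → ℤ) l % (4 * t)) :
    ∃ j k, i ≠ j ∧ i ≠ k ∧ j ≠ k ∧ b j = 2 * t + 1 ∧ b k = 4 * t - 2 := by
  have h0 := hb 0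
  have h1 := hb 1
  have h2 := hb 2
  simp only [Matrix.cons_val] at h0 h1 h2
  fin_cases i
  · change b 0 = 1 at hi
    rw [h0] at hi
    have hq := Int.emod_add_mul_ediv (s * 1) (4 * t)
    rw [hi] at hq
    refine ⟨1, 2, by decide, by decide, by decide, ?_, ?_⟩
    · rw [h1, emod_eq_of_eq_add_mul (c := 2 * t + 1) (q := s * 1 / (4 * t) * (2 * t + 1))
        (by linear_combination -(2 * t + 1) * hq) (by omega) (by omega)]
    · rw [h2, emod_eq_of_eq_add_mul (c := 4 * t - 2) (q := s * 1 / (4 * t) * (4 * t - 2))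
        (by linear_combination -(4 * t - 2) * hq) (by omega) (by omega)]
  · -- Modulo `4 t`, the entry `2 t + 1` is its own inverse.
    change b 1 = 1 at hi
    rw [h1] at hi
    have hq := Int.emod_add_mul_ediv (s * (2 * t + 1)) (4 * t)
    rw [hi] at hq
    set q := s * (2 * t + 1) / (4 * t)
    have hs : s = 2 * t + 1 + 4 * t * (q * (2 * t + 1) - s * (t + 1)) := by
      linear_combination -(2 * t + 1) * hq
    refine ⟨0, 2, by decide, by decide, by decide, ?_, ?_⟩
    · rw [h0, emod_eq_of_eq_add_mul (c := 2 * t + 1) (q := q * (2 * t + 1) - s * (t + 1))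
        (by linear_combination hs) (by omega) (by omega)]
    · rw [h2, emod_eq_of_eq_add_mul (c := 4 * t - 2)
        (q := (q * (2 * t + 1) - s * (t + 1)) * (4 * t - 2) + 2 * t - 1)
        (by linear_combination (4 * t - 2) * hs) (by omega) (by omega)]
  · -- The third entry of every multiple is even.
    change b 2 = 1 at hi
    rw [h2] at hi
    have hq := Int.emod_add_mul_ediv (s * (4 * t - 2)) (4 * t)
    rw [hi] at hq
    have : (2 : ℤ) ∣ 1 :=
      ⟨s * (2 * t - 1) - 2 * t * (s * (4 * t - 2) / (4 * t)), by linear_combination hq⟩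
    omega

theorem numerators_nine {b : Fin 3 → ℤ} {i : Fin 3} {s : ℤ} (hi : b i = 1)
    (hb : ∀ l, b l = s * (![1, 4, 7] : Fin 3 → ℤ) l % 9) :
    ∃ j k, i ≠ j ∧ i ≠ k ∧ j ≠ k ∧ b j = 4 ∧ b k = 7 := by
  have h0 := hb 0
  have h1 := hb 1
  have h2 := hb 2
  simp only [Matrix.cons_val] at h0 h1 h2
  fin_cases i
  · change b 0 = 1 at hi
    exact ⟨1, 2, by decide, by decide, by decide, by omega, by omega⟩
  · change b 1 = 1 at hi
    exact ⟨2, 0, by decide, by decide, by decide, by omega, by omega⟩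
  · change b 2 = 1 at hi
    exact ⟨0, 1, by decide, by decide, by decide, by omega, by omega⟩

theorem numerators_fourteen {b : Fin 3 → ℤ} {i : Fin 3} {s : ℤ} (hi : b i = 1)
    (hb : ∀ l, b l = s * (![1, 9, 11] : Fin 3 → ℤ) l % 14) :
    ∃ j k, i ≠ j ∧ i ≠ k ∧ j ≠ k ∧ b j = 9 ∧ b k = 11 := by
  have h0 := hb 0
  have h1 := hb 1
  have h2 := hb 2
  simp only [Matrix.cons_val] at h0 h1 h2
  fin_cases i
  · change b 0 = 1 at hi
    exact ⟨1, 2, by decide, by decide, by decide, by omega, by omega⟩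
  · change b 1 = 1 at hi
    exact ⟨2, 0, by decide, by decide, by decide, by omega, by omega⟩
  · change b 2 = 1 at hi
    exact ⟨0, 1, by decide, by decide, by decide, by omega, by omega⟩

/-- All that is claimed about a resolution follows from the values of `maxConeCount` and
`vertexCoords`, once there are at least `#G + 3` vertices: then the primitive generators are too
many to form the Hilbert basis. -/
theorem fujikiOkaFan_properties {m : ℤ} {g a : Fin 3 → ℤ} {i j k : Fin 3}
    (hg : g 0 = 1) (ha : IsSemiUnimodular m a i) (h : cyclicGroup m a = cyclicGroup m g)
    (hij : i ≠ j) (hik : i ≠ k) (hjk : j ≠ k) {n : ℕ} (hn : m ≤ n + 1)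
    (hcard : m.toNat + 3 ≤ (vertexCoords n m (a j) (a k)).card) :
    (∀ τ ∈ fujikiOkaFan m a i, IsSmoothCone (cyclicLattice m g) τ) ∧
      numSmoothMaxCones (cyclicLattice m g) (fujikiOkaFan m a i) =
        maxConeCount n m (a j) (a k) ∧
      numVertices (fujikiOkaFan m a i) = (vertexCoords n m (a j) (a k)).card ∧
      Nat.card (cyclicGroup m g) = m.toNat ∧
      Nat.card (cyclicGroup m g) + 3 ≤ numVertices (fujikiOkaFan m a i) ∧
      (hilbertBasis (cyclicLattice m g) (PointedCone.positive ℝ (Fin 3 → ℝ))).encard ≤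
        Nat.card (cyclicGroup m g) + 2 ∧
      gen (cyclicLattice m g) (fujikiOkaFan m a i) ≠
        hilbertBasis (cyclicLattice m g) (PointedCone.positive ℝ (Fin 3 → ℝ)) ∧
      ¬ IsHilbertDesingularization (cyclicLattice m g) (PointedCone.positive ℝ (Fin 3 → ℝ))
        (fujikiOkaFan m a i) := by
  have hred := ha.isReduced
  have hli := linearIndependent_single 3
  have hN : cyclicLattice m g = cyclicLattice m a :=
    le_antisymm (cyclicLattice_le_of_cyclicGroup_le h.ge) (cyclicLattice_le_of_cyclicGroup_le h.le)
  have hG : Nat.card (cyclicGroup m g) = m.toNat := card_cyclicGroup hred.pos hg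
  have hF : numSmoothMaxCones (cyclicLattice m g) (fujikiOkaFan m a i) =
      maxConeCount n m (a j) (a k) := by
    rw [hN, numSmoothMaxCones_fujikiOkaFan hred, Set.ncard,
      encard_maxCone hij hik hjk n hn hred hli, ENat.toNat_natCast]
  have hV : numVertices (fujikiOkaFan m a i) = (vertexCoords n m (a j) (a k)).card := by
    rw [numVertices_fujikiOkaFan hred, ncard_vertexVectors hij hik hjk n hn hred hli]
  have hH : (hilbertBasis (cyclicLattice m g) (PointedCone.positive ℝ (Fin 3 → ℝ))).encard ≤
      Nat.card (cyclicGroup m g) + 2 := by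
    rw [hG]
    exact_mod_cast encard_hilbertBasis_le hred.pos g
  have hgen : gen (cyclicLattice m g) (fujikiOkaFan m a i) ≠
      hilbertBasis (cyclicLattice m g) (PointedCone.positive ℝ (Fin 3 → ℝ)) := by
    intro he
    have h1 := Set.encard_le_encard (vertexVectors_subset_gen hred)
    rw [← hN, he] at h1
    have h2 := (Set.ncard_le_encard _).trans (h1.trans hH)
    rw [ncard_vertexVectors hij hik hjk n hn hred hli, hG] at h2
    have h3 : (vertexCoords n m (a j) (a k)).card ≤ m.toNat + 2 := by exact_mod_cast h2
    omega
  refine ⟨fun τ hτ => ?_, hF, hV, hG, by rw [hG, hV]; exact hcard, hH, hgen, fun hD => hgen hD.2.2⟩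
  rw [hN]
  exact isSmoothCone_of_mem_fujikiOkaFan hred hτ

end FujikiOka

theorem mainTheorem4 :
    (∀ (m : ℤ) (g : Fin 3 → ℤ),
      ((∃ d r a : ℤ, 1 < d ∧ 0 < a ∧ a < r ∧ Int.gcd r a = 1 ∧
          m = d * r ∧ g = ![1, d * r - 1, a * d]) ∨
        (∃ k : ℤ, 2 ≤ k ∧ m = 4 * k ∧ g = ![1, 2 * k + 1, 4 * k - 2])) →
      ∀ Δ : Set (PointedCone ℝ (Fin 3 → ℝ)),
        FujikiOka.IsFujikiOkaResolution (FujikiOka.cyclicGroup m g) Δ →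
          (∀ τ ∈ Δ, FujikiOka.IsSmoothCone (FujikiOka.cyclicLattice m g) τ) ∧
          2 * Nat.card (FujikiOka.cyclicGroup m g) ≤
            FujikiOka.numSmoothMaxCones (FujikiOka.cyclicLattice m g) Δ ∧
          Nat.card (FujikiOka.cyclicGroup m g) + 3 ≤ FujikiOka.numVertices Δ ∧
          (FujikiOka.hilbertBasis (FujikiOka.cyclicLattice m g)
            (PointedCone.positive ℝ (Fin 3 → ℝ))).encard ≤
              Nat.card (FujikiOka.cyclicGroup m g) + 2 ∧
          FujikiOka.gen (FujikiOka.cyclicLattice m g) Δ ≠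
            FujikiOka.hilbertBasis (FujikiOka.cyclicLattice m g)
              (PointedCone.positive ℝ (Fin 3 → ℝ)) ∧
          ¬ FujikiOka.IsHilbertDesingularization (FujikiOka.cyclicLattice m g)
            (PointedCone.positive ℝ (Fin 3 → ℝ)) Δ) ∧
    (∀ (m : ℤ) (g : Fin 3 → ℤ) (F V : ℕ),
      ((m = 9 ∧ g = ![1, 4, 7] ∧ F = 23 ∧ V = 14) ∨
        (m = 14 ∧ g = ![1, 9, 11] ∧ F = 43 ∧ V = 24)) →
      ∀ Δ : Set (PointedCone ℝ (Fin 3 → ℝ)),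
        FujikiOka.IsFujikiOkaResolution (FujikiOka.cyclicGroup m g) Δ →
          (∀ τ ∈ Δ, FujikiOka.IsSmoothCone (FujikiOka.cyclicLattice m g) τ) ∧
          FujikiOka.numSmoothMaxCones (FujikiOka.cyclicLattice m g) Δ = F ∧
          FujikiOka.numVertices Δ = V ∧
          Nat.card (FujikiOka.cyclicGroup m g) + 3 ≤ FujikiOka.numVertices Δ ∧
          (FujikiOka.hilbertBasis (FujikiOka.cyclicLattice m g)
            (PointedCone.positive ℝ (Fin 3 → ℝ))).encard ≤
              Nat.card (FujikiOka.cyclicGroup m g) + 2 ∧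
          FujikiOka.gen (FujikiOka.cyclicLattice m g) Δ ≠
            FujikiOka.hilbertBasis (FujikiOka.cyclicLattice m g)
              (PointedCone.positive ℝ (Fin 3 → ℝ)) ∧
          ¬ FujikiOka.IsHilbertDesingularization (FujikiOka.cyclicLattice m g)
            (PointedCone.positive ℝ (Fin 3 → ℝ)) Δ) := by
  refine ⟨?_, ?_⟩
  · rintro m g hmg Δ ⟨r, b, i, hb, hG, rfl⟩
    have hm : 0 < m := by
      rcases hmg with ⟨d, r, a, hd, ha, har, -, rfl, -⟩ | ⟨k, hk, rfl, -⟩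
      · exact mul_pos (by omega) (by omega)
      · omega
    have hg : g 0 = 1 := by
      rcases hmg with ⟨d, r, a, -, -, -, -, -, rfl⟩ | ⟨k, -, -, rfl⟩ <;> rfl
    obtain ⟨rfl, s, hs⟩ := FujikiOka.exists_eq_mul_emod hm hg hb hG
    have hn : r ≤ (r.toNat : ℕ) + 1 := by omega
    obtain ⟨j, k, hij, hik, hjk, hF, hprim⟩ : ∃ j k, i ≠ j ∧ i ≠ k ∧ j ≠ k ∧
        2 * r ≤ (FujikiOka.maxConeCount r.toNat r (b j) (b k) : ℤ) ∧
        ∀ e : ℤ, e ∣ r → e ∣ b j → e ∣ b k → e ∣ 1 := by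
      rcases hmg with ⟨d, q, a, hd, ha, haq, -, rfl, rfl⟩ | ⟨t, ht, rfl, rfl⟩
      · obtain ⟨j, k, hij, hik, hjk, hj, hk, hk'⟩ :=
          FujikiOka.numerators_sub_one hd ha haq hb.2 hs
        refine ⟨j, k, hij, hik, hjk, ?_, fun e h1 h2 _ => ?_⟩
        · rw [hj]
          exact FujikiOka.two_mul_le_maxConeCount_sub_one _ hn hk hk'
        · rw [hj] at h2
          simpa using dvd_sub h1 h2
      · obtain ⟨j, k, hij, hik, hjk, hj, hk⟩ := FujikiOka.numerators_four_mul ht hb.2 hs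
        refine ⟨j, k, hij, hik, hjk, ?_, fun e h1 h2 _ => ?_⟩
        · rw [hj, hk]
          exact FujikiOka.two_mul_le_maxConeCount_four_mul _ hn ht
        · rw [hj] at h2
          have h3 := dvd_add (h1.mul_left t) (h2.mul_left (1 - 2 * t))
          rwa [show t * (4 * t) + (1 - 2 * t) * (2 * t + 1) = 1 by ring] at h3
    have hV := FujikiOka.maxConeCount_add_five_le r.toNat hm (hb.1 j).1 (hb.1 k).1 hprim
    obtain ⟨h1, h2, -, h4, h5, h6, h7, h8⟩ :=
      FujikiOka.fujikiOkaFan_properties hg hb hG hij hik hjk hn (by omega)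
    refine ⟨h1, ?_, h5, h6, h7, h8⟩
    rw [h2, h4]
    omega
  · rintro m g F V hmg Δ ⟨r, b, i, hb, hG, rfl⟩
    have hm : 0 < m := by rcases hmg with ⟨rfl, -⟩ | ⟨rfl, -⟩ <;> norm_num
    have hg : g 0 = 1 := by rcases hmg with ⟨-, rfl, -⟩ | ⟨-, rfl, -⟩ <;> rfl
    obtain ⟨rfl, s, hs⟩ := FujikiOka.exists_eq_mul_emod hm hg hb hG
    obtain ⟨j, k, n, hij, hik, hjk, hn, hF, hV, hle⟩ : ∃ (j k : Fin 3) (n : ℕ),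
        i ≠ j ∧ i ≠ k ∧ j ≠ k ∧ r ≤ n + 1 ∧ FujikiOka.maxConeCount n r (b j) (b k) = F ∧
        (FujikiOka.vertexCoords n r (b j) (b k)).card = V ∧ r.toNat + 3 ≤ V := by
      rcases hmg with ⟨rfl, rfl, rfl, rfl⟩ | ⟨rfl, rfl, rfl, rfl⟩
      · obtain ⟨j, k, hij, hik, hjk, hj, hk⟩ := FujikiOka.numerators_nine hb.2 hs
        refine ⟨j, k, 8, hij, hik, hjk, by norm_num, ?_, ?_, by decide⟩ <;> rw [hj, hk]
        exacts [FujikiOka.maxConeCount_nine, FujikiOka.card_vertexCoords_nine]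
      · obtain ⟨j, k, hij, hik, hjk, hj, hk⟩ := FujikiOka.numerators_fourteen hb.2 hs
        refine ⟨j, k, 13, hij, hik, hjk, by norm_num, ?_, ?_, by decide⟩ <;> rw [hj, hk]
        exacts [FujikiOka.maxConeCount_fourteen, FujikiOka.card_vertexCoords_fourteen]
    obtain ⟨h1, h2, h3, -, h5, h6, h7, h8⟩ :=
      FujikiOka.fujikiOkaFan_properties hg hb hG hij hik hjk hn (by rw [hV]; exact hle)
    exact ⟨h1, h2.trans hF, h3.trans hV, h5, h6, h7, h8⟩
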